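/- **Theorem.** Let $L\ge 2$, let $P_1,\dots,P_L$ be probability distributions on $\mathbb R^d$ with its Borel $\sigma$-algebra, let $\Pi=(\pi_{i,j})$ be a row-stochastic $L\times L$ matrix, and let $\tilde P_i=\sum_{j=1}^L\pi_{i,j}P_j$. Assume that * $P_1,\dots,P_L$ are jointly irreducible: if $\gamma\in\mathbb R^L$ and $\sum_{i}\gamma_iP_i$ is a probability distribution, then $\gamma_i\ge 0$ for all $i$; * $\Pi$ is invertible, and $\Pi^{-1}$ has strictly positive diagonal entries and nonpositive off-diagonal entries. For each $i$ let $X^i_1,X^i_2,\dots$ be i.i.d. with law $\tilde P_i$, all defined on one probability space, and for $n_i\ge1$ let $\hat P_i(S)=\frac1{n_i}\sum_{j=1}^{n_i}\mathbf 1\{X^i_j\in S\}$ be the empirical distribution of the first $n_i$ points. Let $\mathcal S$ be a class of Borel sets of finite VC dimension $V$ that contains all open Euclidean balls, or all open (axis-parallel, nonempty, bounded) rectangles, or some other collection $\mathcal G$ of sets such that for every probability distribution $F$, every open set is, up to an $F$-null set, a countable disjoint union of members of $\mathcal G$. Assume that $\mathcal S$ satisfies the usual measurability condition of empirical process theory for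 each $\tilde P_i$: for all $n$ and $e\in\mathbb R^n$, the map $(x_1,\dots,x_n)\mapsto\sup_{S\in\mathcal S}\bigl|\sum_{j}e_j\mathbf 1\{x_j\in S\}\bigr|$ is measurable for the completion of $\tilde P_i^{\otimes n}$. Put $\epsilon_i=3\sqrt{\bigl(V\log(n_i+1)-\log(\tfrac1{2n_i})\bigr)/n_i}$, let $\Delta^{(i)}$ be the set of nonnegative vectors $(\mu_j)_{j\ne i}$ with sum $1$, and define $$\hat\kappa_i=\max_{\mu\in\Delta^{(i)}}\ \inf_{S\in\mathcal S}\ \frac{\hat P_i(S)+\epsilon_i}{\bigl(\sum_{j\ne i}\mu_j\hat P_j(S)-\sum_{j\ne i}\mu_j\epsilon_j\bigr)_+}\in[0,\infty],$$ the ratio being $\infty$ when its denominator is $0$. Then, for all samples and all sizes $n_1,\dots,n_L\ge1$, this maximum is attained. Moreover, for any choice of maximizers $\hat\mu_i=(\hat\mu_{i,j})_{j\neq i}$ (not necessarily measurable in the samples), with $\hat\nu_{i,j}=\hat\kappa_i\hat\mu_{i,j}$ and $$\hat Q_i=\frac{\hat P_i-\sum_{j\ne i}\hat\nu_{i,j}\hat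 P_j}{1-\hat\kappa_i}$$ (with an arbitrary convention when $\hat\kappa_i\in\{1,\infty\}$), one has for every $i=1,\dots,L$ $$\sup_{S\in\mathcal S}|\hat Q_i(S)-P_i(S)|\longrightarrow 0\quad\text{in (outer) probability as }\min_i n_i\to\infty .$$ -/

import Mathlib

open MeasureTheory ProbabilityTheory Filter
open scoped ENNReal

noncomputable section

namespace MutualContamination

/-! ### Mutual contamination models -/

/-- Joint irreducibility: whenever a real linear combination `∑ i, γ i • P i` is a probability
distribution `Q`, all its coefficients are nonnegative. -/
def JointlyIrreducible {α : Type*} [MeasurableSpace α] {L : ℕ} (P : Fin L → Measure α) : Prop :=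
  ∀ (γ : Fin L → ℝ) (Q : Measure α), IsProbabilityMeasure Q →
    (∀ A, MeasurableSet A → Q.real A = ∑ i, γ i * (P i).real A) → ∀ i, 0 ≤ γ i

/-- The contaminated distribution `∑ j, M i j • P j` of index `i` (the entries of the mixing matrix
`M` are nonnegative whenever this is used). -/
def contaminated {α : Type*} [MeasurableSpace α] {L : ℕ} (M : Matrix (Fin L) (Fin L) ℝ)
    (P : Fin L → Measure α) (i : Fin L) : Measure α :=
  ∑ j, ENNReal.ofReal (M i j) • P j

/-- The mixing matrix is invertible, and its inverse has strictly positive diagonal entries and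
nonpositive off-diagonal entries. -/
def LowNoise {L : ℕ} (M : Matrix (Fin L) (Fin L) ℝ) : Prop :=
  IsUnit M ∧ (∀ i, 0 < M⁻¹ i i) ∧ ∀ i j, i ≠ j → M⁻¹ i j ≤ 0

/-! ### Classes of sets -/

/-- The class `𝒮` shatters the finite set `A`. -/
def ShattersSet {α : Type*} (𝒮 : Set (Set α)) (A : Finset α) : Prop :=
  ∀ B : Set α, B ⊆ ↑A → ∃ S ∈ 𝒮, ↑A ∩ S = B

/-- `𝒮` has (finite) Vapnik-Chervonenkis dimension equal to `V`. -/
def HasVCDim {α : Type*} (𝒮 : Set (Set α)) (V : ℕ) : Prop :=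
  (∃ A : Finset α, A.card = V ∧ ShattersSet 𝒮 A) ∧
    ∀ A : Finset α, ShattersSet 𝒮 A → A.card ≤ V

/-- The Euclidean space `ℝ^d`. -/
abbrev Space (d : ℕ) : Type := EuclideanSpace ℝ (Fin d)

/-- The collection of all open Euclidean balls of `ℝ^d`. -/
def openBalls (d : ℕ) : Set (Set (Space d)) :=
  {S | ∃ (x : Space d) (r : ℝ), 0 < r ∧ S = Metric.ball x r}

/-- The collection of all (nonempty, bounded, axis-parallel) open rectangles of `ℝ^d`. -/
def openRectangles (d : ℕ) : Set (Set (Space d)) :=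
  {S | ∃ a b : Fin d → ℝ, (∀ k, a k < b k) ∧ S = {x | ∀ k, a k < x k ∧ x k < b k}}

/-- For every probability distribution `F`, every open set is, up to an `F`-null set, a countable
disjoint union of members of `𝒢`. -/
def PacksOpenSets {d : ℕ} (𝒢 : Set (Set (Space d))) : Prop :=
  ∀ F : Measure (Space d), IsProbabilityMeasure F → ∀ U : Set (Space d), IsOpen U →
    ∃ 𝒯 : Set (Set (Space d)), 𝒯 ⊆ 𝒢 ∧ 𝒯.Countable ∧ 𝒯.PairwiseDisjoint id ∧
      (∀ S ∈ 𝒯, S ⊆ U) ∧ F (U \ ⋃₀ 𝒯) = 0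

/-- The class contains all open balls, or all open rectangles, or some other collection of sets
rich enough to pack open sets. -/
def IsRich {d : ℕ} (𝒮 : Set (Set (Space d))) : Prop :=
  openBalls d ⊆ 𝒮 ∨ openRectangles d ⊆ 𝒮 ∨ ∃ 𝒢 ⊆ 𝒮, PacksOpenSets 𝒢

/-- Measurability of a class of sets relative to a distribution `F`, in the usual sense of
empirical process theory: for all `n` and all real `e 0, …, e (n - 1)`, the map
`x ↦ sup_{S ∈ 𝒮} |∑ j, e j * 1_S (x j)|` is measurable for the completion of `F ^ n`. -/
def IsMeasurableClass {α : Type*} [MeasurableSpace α] (𝒮 : Set (Set α)) (F : Measure α) : Prop :=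
  ∀ (n : ℕ) (e : Fin n → ℝ),
    AEMeasurable (fun x : Fin n → α => ⨆ S : 𝒮, |∑ j, e j * (S : Set α).indicator 1 (x j)|)
      (Measure.pi fun _ => F)

/-! ### The estimators -/

/-- The empirical distribution of the first `n` points of `x`, as a function of sets. -/
def empirical {α : Type*} (x : ℕ → α) (n : ℕ) (S : Set α) : ℝ :=
  (∑ j ∈ Finset.range n, S.indicator (1 : α → ℝ) (x j)) / n

/-- `ε(δ) = 3 √((V log (n + 1) - log (δ / 2)) / n)` for sample size `n` and VC dimension `V`. -/
def epsRadius (V n : ℕ) (δ : ℝ) : ℝ :=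
  3 * Real.sqrt ((V * Real.log (n + 1) - Real.log (δ / 2)) / n)

section

variable {α : Type*} {L : ℕ} (𝒮 : Set (Set α)) (V : ℕ)
  (n : Fin L → ℕ) (x : Fin L → ℕ → α) (i : Fin L)

/-- `∑_{j ≠ i} μ_j F̂_j(S) - ∑_{j ≠ i} μ_j ε_j(1 / n_j)`, where `F̂_j` is the empirical distribution
of `x j 0, …, x j (n j - 1)`. -/
def ratioDenom (μ : {j : Fin L // j ≠ i} → ℝ) (S : Set α) : ℝ :=
  ∑ j, μ j * empirical (x j) (n j) S - ∑ j, μ j * epsRadius V (n j) (1 / n j)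

/-- The ratio `(F̂_i(S) + ε_i(1 / n_i)) / (∑_{j ≠ i} μ_j F̂_j(S) - ∑_{j ≠ i} μ_j ε_j(1 / n_j))₊`,
which is `∞` when the positive part in the denominator vanishes. -/
def ratio (μ : {j : Fin L // j ≠ i} → ℝ) (S : Set α) : ℝ≥0∞ :=
  if ratioDenom V n x i μ S ≤ 0 then ⊤
  else ENNReal.ofReal
    ((empirical (x i) (n i) S + epsRadius V (n i) (1 / n i)) / ratioDenom V n x i μ S)

/-- The objective `inf_{S ∈ 𝒮}` of the ratio, as a function of the weights. -/
def objective (μ : {j : Fin L // j ≠ i} → ℝ) : ℝ≥0∞ :=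
  ⨅ S ∈ 𝒮, ratio V n x i μ S

/-- The empirical multi-sample `κ̂_i` of the `i`-th sample with respect to all the others. -/
def kappaHat : ℝ≥0∞ :=
  ⨆ μ ∈ stdSimplex ℝ {j : Fin L // j ≠ i}, objective 𝒮 V n x i μ

/-- `μ` is a point of the simplex at which the maximum defining `κ̂_i` is achieved. -/
def IsMaximizingWeight (μ : {j : Fin L // j ≠ i} → ℝ) : Prop :=
  μ ∈ stdSimplex ℝ {j : Fin L // j ≠ i} ∧ objective 𝒮 V n x i μ = kappaHat 𝒮 V n x i

/-- `Q̂_i = (F̂_i - ∑_{j ≠ i} ν̂_j F̂_j) / (1 - κ̂_i)` with `ν̂ = κ̂_i μ`, as a function of sets. -/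
def QHat (μ : {j : Fin L // j ≠ i} → ℝ) (S : Set α) : ℝ :=
  (empirical (x i) (n i) S
      - ∑ j, ((kappaHat 𝒮 V n x i).toReal * μ j) * empirical (x j) (n j) S)
    / (1 - (kappaHat 𝒮 V n x i).toReal)

end

/-- `sup_{S ∈ 𝒮} |Q(S) - P(S)|`. -/
def supDev {α : Type*} [MeasurableSpace α] (𝒮 : Set (Set α)) (Q : Set α → ℝ) (P : Measure α) : ℝ :=
  ⨆ S : 𝒮, |Q S - P.real S|

end MutualContamination

end

noncomputable section

namespace MutualContamination

/-! ### Sauer's lemma for the traces on a finite sample -/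

/-! Inverting the mixing matrix writes each contaminated law as `(1 - κ*) P_i` plus a nonnegative
combination, with weights `ν*` of total mass `κ* < 1`, of the other contaminated laws. Joint
irreducibility forces `ν*` to be the only weight vector of mass at least `κ*` whose combination
stays below the `i`-th contaminated law (`JointlyIrreducible.eq_nuStar`). On a rich class it is
enough to test this on `𝒮` (`IsRich.measure_le`), and compactness turns uniqueness into stability:
nearly admissible weights of mass at least `κ*` are near `ν*` (`exists_slack`).

The rest is deterministic on the event that all empirical deviations over `𝒮` are within the
confidence radii. There `ν*` is feasible, so `κ̂ ≥ κ*`, and any maximizer yields nearly admissible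
weights; hence `κ̂ μ̂` is near `ν*` and the residue is near `P_i` (`exists_supDev_lt`). Since this
holds for every maximizer, measurability of the choice plays no role.

The event fails with probability at most the sum of the `2 ^ V / n_k`
(`measure_empirical_deviation_le`). This comes from symmetrization with a ghost sample, Sauer's
lemma and exponential moments of Rademacher sums. -/

lemma sum_choose_le_succ_pow (m V : ℕ) : ∑ k ∈ Finset.Iic V, m.choose k ≤ (m + 1) ^ V := by
  rw [add_pow]
  have hI : Finset.Iic V = Finset.range (V + 1) := by ext; simp
  rw [hI]
  refine Finset.sum_le_sum fun k hk => ?_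
  have hk' : k ≤ V := by simpa [Nat.lt_succ_iff] using hk
  calc m.choose k ≤ m ^ k := Nat.choose_le_pow m k
    _ ≤ m ^ k * 1 ^ (V - k) * V.choose k := by
      simpa using Nat.le_mul_of_pos_right _ (Nat.choose_pos hk')

/-- The traces of a class of VC dimension `V` on a sample `z` are polynomially many. -/
lemma HasVCDim.exists_traces {α ι : Type*} [Fintype ι] {𝒮 : Set (Set α)} {V : ℕ}
    (hV : HasVCDim 𝒮 V) (z : ι → α) :
    ∃ 𝒯 : Finset (Finset ι), 𝒯.card ≤ (Fintype.card ι + 1) ^ V ∧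
      ∀ S ∈ 𝒮, ∃ T ∈ 𝒯, ∀ j, j ∈ T ↔ z j ∈ S := by
  classical
  let 𝒯 : Finset (Finset ι) := Finset.univ.filter fun T => ∃ S ∈ 𝒮, ∀ j, j ∈ T ↔ z j ∈ S
  refine ⟨𝒯, ?_, fun S hS => ⟨Finset.univ.filter fun j => z j ∈ S, ?_, by simp⟩⟩
  · have hvc : 𝒯.vcDim ≤ V := by
      refine Finset.sup_le fun I hI => ?_
      have hsh : 𝒯.Shatters I := Finset.mem_shatterer.1 hI
      -- Sample points may repeat, but a shattered index set cannot contain two indices of the same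
      -- point, as no trace separates them.
      have hinj : Set.InjOn z I := by
        intro a ha b hb hab
        obtain ⟨T, hT, hTa⟩ := hsh (Finset.singleton_subset_iff.2 ha)
        obtain ⟨S, -, hS⟩ := (Finset.mem_filter.1 hT).2
        have haT : a ∈ T := (Finset.mem_inter.1 (hTa ▸ Finset.mem_singleton_self a)).2
        have hbT : b ∈ T := (hS b).2 (hab ▸ (hS a).1 haT)
        exact (Finset.mem_singleton.1 (hTa ▸ Finset.mem_inter.2 ⟨hb, hbT⟩)).symm
      rw [← Finset.card_image_of_injOn hinj]
      refine hV.2 _ fun B hB => ?_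
      obtain ⟨T, hT, hTB⟩ := hsh (Finset.filter_subset (fun j => z j ∈ B) I)
      obtain ⟨S, hS, hTS⟩ := (Finset.mem_filter.1 hT).2
      refine ⟨S, hS, Set.Subset.antisymm ?_ fun y hy => ?_⟩
      · rintro _ ⟨hy, hyS⟩
        obtain ⟨j, hj, rfl⟩ := Finset.mem_image.1 (Finset.mem_coe.1 hy)
        have : j ∈ I ∩ T := Finset.mem_inter.2 ⟨hj, (hTS j).2 hyS⟩
        rw [hTB] at this
        exact (Finset.mem_filter.1 this).2
      · obtain ⟨j, hj, rfl⟩ := Finset.mem_image.1 (Finset.mem_coe.1 (hB hy))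
        have : j ∈ I ∩ T := by rw [hTB]; exact Finset.mem_filter.2 ⟨hj, hy⟩
        exact ⟨hB hy, (hTS j).1 (Finset.mem_inter.1 this).2⟩
    calc 𝒯.card ≤ 𝒯.shatterer.card := Finset.card_le_card_shatterer _
      _ ≤ ∑ k ∈ Finset.Iic 𝒯.vcDim, (Fintype.card ι).choose k :=
        Finset.card_shatterer_le_sum_vcDim
      _ ≤ ∑ k ∈ Finset.Iic V, (Fintype.card ι).choose k :=
        Finset.sum_le_sum_of_subset (Finset.Iic_subset_Iic.2 hvc)
      _ ≤ _ := sum_choose_le_succ_pow _ _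
  · simp only [𝒯, Finset.mem_filter, Finset.mem_univ, true_and]
    exact ⟨S, hS, by simp⟩

/-! ### Rademacher averages -/

/-- The sign attached to a Boolean. -/
def boolSign (b : Bool) : ℝ := if b then 1 else -1

/-- The sum over sign patterns factors over coordinates, and each factor is `2 cosh (t a_j) ≤ 2 exp
(t² / 2)`. -/
lemma sum_exp_rademacher_le {n : ℕ} (a : Fin n → ℝ) (ha : ∀ j, |a j| ≤ 1) (t : ℝ) :
    ∑ σ : Fin n → Bool, Real.exp (t * ∑ j, boolSign (σ j) * a j)
      ≤ 2 ^ n * Real.exp (n * (t ^ 2 / 2)) := by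
  have h1 : ∀ σ : Fin n → Bool, Real.exp (t * ∑ j, boolSign (σ j) * a j)
      = ∏ j, Real.exp (t * (boolSign (σ j) * a j)) := fun σ => by
    rw [Finset.mul_sum, Real.exp_sum]
  simp_rw [h1]
  rw [← Fintype.prod_sum (fun j b => Real.exp (t * (boolSign b * a j)))]
  have h2 : ∀ j, ∑ b, Real.exp (t * (boolSign b * a j)) ≤ 2 * Real.exp (t ^ 2 / 2) := by
    intro j
    have hc := Real.cosh_le_exp_half_sq (t * a j)
    rw [Real.cosh_eq] at hc
    have hsq : (t * a j) ^ 2 / 2 ≤ t ^ 2 / 2 := by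
      have : a j ^ 2 ≤ 1 := (sq_le_one_iff_abs_le_one _).2 (ha j)
      nlinarith [sq_nonneg t]
    have he := Real.exp_le_exp.2 hsq
    simp only [Fintype.sum_bool, boolSign, if_true, Bool.false_eq_true, if_false, one_mul,
      neg_mul, mul_neg]
    linarith
  calc _ ≤ ∏ _j : Fin n, (2 * Real.exp (t ^ 2 / 2)) :=
        Finset.prod_le_prod (fun j _ => Finset.sum_nonneg fun b _ => (Real.exp_pos _).le)
          fun j _ => h2 j
    _ = _ := by
      rw [Finset.prod_const, Finset.card_univ, Fintype.card_fin, mul_pow, ← Real.exp_nat_mul]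

lemma sum_exp_abs_rademacher_le {n : ℕ} (a : Fin n → ℝ) (ha : ∀ j, |a j| ≤ 1) (t : ℝ) :
    ∑ σ : Fin n → Bool, Real.exp (t * |∑ j, boolSign (σ j) * a j|)
      ≤ 2 ^ n * (2 * Real.exp (n * (t ^ 2 / 2))) := by
  have h1 := sum_exp_rademacher_le a ha t
  have h2 := sum_exp_rademacher_le a ha (-t)
  rw [neg_sq] at h2
  have h3 : ∀ y : ℝ, Real.exp (t * |y|) ≤ Real.exp (t * y) + Real.exp (-t * y) := by
    intro y
    rcases abs_choice y with h | h <;> rw [h]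
    · linarith [Real.exp_pos (-t * y)]
    · rw [mul_neg, neg_mul]; linarith [Real.exp_pos (t * y)]
  calc _ ≤ ∑ σ : Fin n → Bool, (Real.exp (t * ∑ j, boolSign (σ j) * a j)
        + Real.exp (-t * ∑ j, boolSign (σ j) * a j)) := Finset.sum_le_sum fun σ _ => h3 _
    _ ≤ _ := by rw [Finset.sum_add_distrib]; linarith

/-! ### Measurability over general finite index sets -/

/-- Reindexing is needed because the double sample lives on `Fin n ⊕ Fin n`. -/
lemma IsMeasurableClass.aemeasurable {α ι : Type*} [MeasurableSpace α] [Fintype ι]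
    {𝒮 : Set (Set α)} {F : Measure α} [IsProbabilityMeasure F] (h : IsMeasurableClass 𝒮 F)
    (e : ι → ℝ) :
    AEMeasurable (fun x : ι → α => ⨆ S : 𝒮, |∑ j, e j * (S : Set α).indicator 1 (x j)|)
      (Measure.pi fun _ => F) := by
  let φ := Fintype.equivFin ι
  have hmp := measurePreserving_piCongrLeft (fun _ : Fin (Fintype.card ι) => F) φ
  refine ((h _ (e ∘ φ.symm)).comp_quasiMeasurePreserving hmp.quasiMeasurePreserving).congr
    (Eventually.of_forall fun x => ?_)
  simp only [Function.comp]
  congr 1; funext S; congr 1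
  rw [← φ.sum_comp]
  simp [MeasurableEquiv.piCongrLeft]

/-! ### The Vapnik-Chervonenkis inequality -/

/-- The coefficients of the signed difference of a sample and its ghost sample. -/
def ghostSign {n : ℕ} (σ : Fin n → Bool) : Fin n ⊕ Fin n → ℝ :=
  Sum.elim (fun j => boolSign (σ j)) fun j => -boolSign (σ j)

/-- `sup_{S ∈ 𝒮} |∑ j, σ j * (1_S (x j) - 1_S (x' j))|` for a sample with ghost sample. -/
def ghostSup {α : Type*} (𝒮 : Set (Set α)) {n : ℕ} (σ : Fin n → Bool) (z : Fin n ⊕ Fin n → α) :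
    ℝ :=
  ⨆ S : 𝒮, |∑ k, ghostSign σ k * (S : Set α).indicator 1 (z k)|

/-- The permutation exchanging `x j` and `x' j` for those `j` with `σ j = false`. -/
def ghostSwap {n : ℕ} (σ : Fin n → Bool) : Equiv.Perm (Fin n ⊕ Fin n) :=
  Function.Involutive.toPerm
    (Sum.elim (fun j => if σ j then Sum.inl j else Sum.inr j)
      fun j => if σ j then Sum.inr j else Sum.inl j)
    (by rintro (j | j) <;> cases h : σ j <;> simp [h])

/-- Exchanging a point with its ghost flips the sign of the corresponding summand. -/
lemma ghostSup_comp_ghostSwap {α : Type*} (𝒮 : Set (Set α)) {n : ℕ} (σ : Fin n → Bool)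
    (z : Fin n ⊕ Fin n → α) :
    ghostSup 𝒮 (fun _ => true) (fun k => z (ghostSwap σ k)) = ghostSup 𝒮 σ z := by
  unfold ghostSup
  congr 1; funext S; congr 1
  simp only [Fintype.sum_sum_type, ← Finset.sum_add_distrib]
  refine Finset.sum_congr rfl fun j _ => ?_
  cases h : σ j <;>
    simp [ghostSign, ghostSwap, boolSign, h, Function.Involutive.toPerm]
  ring

/-- The symmetrised exponential moment, conditionally on the double sample. -/
lemma sum_exp_ghostSup_le {α : Type*} {𝒮 : Set (Set α)} {V : ℕ} (hV : HasVCDim 𝒮 V)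
    {n : ℕ} (z : Fin n ⊕ Fin n → α) (t : ℝ) :
    ∑ σ : Fin n → Bool, Real.exp (t * ghostSup 𝒮 σ z)
      ≤ 2 ^ n * ((2 * n + 1) ^ V * (2 * Real.exp (n * (t ^ 2 / 2)))) := by
  classical
  obtain ⟨𝒯, hcard, hT⟩ := hV.exists_traces z
  have hne : Nonempty 𝒮 := by
    obtain ⟨⟨A, -, hA⟩, -⟩ := hV
    obtain ⟨S, hS, -⟩ := hA ∅ (Set.empty_subset _)
    exact ⟨⟨S, hS⟩⟩
  let a : Finset (Fin n ⊕ Fin n) → Fin n → ℝ := fun T j =>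
    (if Sum.inl j ∈ T then 1 else 0) - if Sum.inr j ∈ T then 1 else 0
  have ha : ∀ T j, |a T j| ≤ 1 := fun T j => by
    simp only [a]; split_ifs <;> simp
  have hval : ∀ (σ : Fin n → Bool) (S : 𝒮), ∃ T ∈ 𝒯,
      |∑ k, ghostSign σ k * (S : Set α).indicator 1 (z k)| = |∑ j, boolSign (σ j) * a T j| := by
    intro σ S
    obtain ⟨T, hTm, hTS⟩ := hT S S.2
    refine ⟨T, hTm, ?_⟩
    congr 1
    simp only [Fintype.sum_sum_type, ← Finset.sum_add_distrib]
    refine Finset.sum_congr rfl fun j _ => ?_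
    simp only [a, ghostSign, Sum.elim_inl, Sum.elim_inr, hTS, Set.indicator_apply, Pi.one_apply]
    ring
  -- Only finitely many values occur on a fixed sample, so the supremum is attained and its
  -- exponential is bounded by the sum over traces.
  have hsup : ∀ σ : Fin n → Bool, ∃ T ∈ 𝒯, ghostSup 𝒮 σ z = |∑ j, boolSign (σ j) * a T j| := by
    intro σ
    have hfin : (Set.range fun S : 𝒮 =>
        |∑ k, ghostSign σ k * (S : Set α).indicator 1 (z k)|).Finite := by
      refine (𝒯.finite_toSet.image fun T => |∑ j, boolSign (σ j) * a T j|).subset ?_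
      rintro _ ⟨S, rfl⟩
      obtain ⟨T, hTm, h⟩ := hval σ S
      exact ⟨T, hTm, h.symm⟩
    obtain ⟨S, hS⟩ := (Set.range_nonempty _).csSup_mem hfin
    obtain ⟨T, hTm, h⟩ := hval σ S
    exact ⟨T, hTm, hS.symm.trans h⟩
  calc ∑ σ : Fin n → Bool, Real.exp (t * ghostSup 𝒮 σ z)
      ≤ ∑ σ : Fin n → Bool, ∑ T ∈ 𝒯, Real.exp (t * |∑ j, boolSign (σ j) * a T j|) := by
        refine Finset.sum_le_sum fun σ _ => ?_
        obtain ⟨T, hTm, h⟩ := hsup σ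
        rw [h]
        exact Finset.single_le_sum (f := fun T => Real.exp (t * |∑ j, boolSign (σ j) * a T j|))
          (fun _ _ => (Real.exp_pos _).le) hTm
    _ = ∑ T ∈ 𝒯, ∑ σ : Fin n → Bool, Real.exp (t * |∑ j, boolSign (σ j) * a T j|) :=
        Finset.sum_comm
    _ ≤ ∑ T ∈ 𝒯, 2 ^ n * (2 * Real.exp (n * (t ^ 2 / 2))) :=
        Finset.sum_le_sum fun T _ => sum_exp_abs_rademacher_le (a T) (ha T) t
    _ = 𝒯.card * (2 ^ n * (2 * Real.exp (n * (t ^ 2 / 2)))) := by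
        rw [Finset.sum_const, nsmul_eq_mul]
    _ ≤ (2 * n + 1) ^ V * (2 ^ n * (2 * Real.exp (n * (t ^ 2 / 2)))) := by
        gcongr
        have : (𝒯.card : ℝ) ≤ ((Fintype.card (Fin n ⊕ Fin n) + 1) ^ V : ℕ) := by
          exact_mod_cast hcard
        refine this.trans (le_of_eq ?_)
        simp only [Fintype.card_sum, Fintype.card_fin]
        push_cast
        ring
    _ = _ := by ring

lemma bddAbove_ghost {α : Type*} {𝒮 : Set (Set α)} {n : ℕ} (σ : Fin n → Bool)
    (z : Fin n ⊕ Fin n → α) :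
    BddAbove (Set.range fun S : 𝒮 =>
      |∑ k, ghostSign σ k * (S : Set α).indicator (1 : α → ℝ) (z k)|) := by
  refine ⟨∑ k, |ghostSign σ k|, ?_⟩
  rintro _ ⟨S, rfl⟩
  refine (Finset.abs_sum_le_sum_abs _ _).trans (Finset.sum_le_sum fun k _ => ?_)
  rw [abs_mul]
  refine mul_le_of_le_one_right (abs_nonneg _) ?_
  by_cases h : z k ∈ (S : Set α) <;> simp [h]

section VC

variable {α : Type*} [MeasurableSpace α] {𝒮 : Set (Set α)} {V : ℕ} {F : Measure α}

lemma aemeasurable_exp_ghostSup [IsProbabilityMeasure F] (hm : IsMeasurableClass 𝒮 F) {n : ℕ}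
    (σ : Fin n → Bool) (t : ℝ) :
    AEMeasurable (fun z => ENNReal.ofReal (Real.exp (t * ghostSup 𝒮 σ z)))
      (Measure.pi fun _ : Fin n ⊕ Fin n => F) :=
  (Real.measurable_exp.comp_aemeasurable
    ((hm.aemeasurable (ghostSign σ)).const_mul t)).ennreal_ofReal

/-- The product law of the double sample is invariant under the swaps. The unsigned moment may
therefore be replaced by its average over all sign patterns, which is bounded pointwise. -/
lemma lintegral_exp_ghostSup_eq [IsProbabilityMeasure F] {n : ℕ} (σ : Fin n → Bool) (t : ℝ) :
    ∫⁻ z, ENNReal.ofReal (Real.exp (t * ghostSup 𝒮 σ z)) ∂(Measure.pi fun _ => F) =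
      ∫⁻ z, ENNReal.ofReal (Real.exp (t * ghostSup 𝒮 (fun _ : Fin n => true) z))
        ∂(Measure.pi fun _ => F) := by
  have hmp := measurePreserving_piCongrLeft (fun _ : Fin n ⊕ Fin n => F) (ghostSwap σ)
  rw [hmp.lintegral_map_equiv]
  refine lintegral_congr fun z => ?_
  rw [← ghostSup_comp_ghostSwap]
  congr 4
  funext k
  simp [MeasurableEquiv.piCongrLeft]

/-- The exponential moment of the maximal deviation of a sample from its ghost sample. -/
lemma lintegral_exp_ghostSup_le [IsProbabilityMeasure F] (hV : HasVCDim 𝒮 V)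
    (hm : IsMeasurableClass 𝒮 F) (n : ℕ) (t : ℝ) :
    ∫⁻ z, ENNReal.ofReal (Real.exp (t * ghostSup 𝒮 (fun _ : Fin n => true) z))
        ∂(Measure.pi fun _ => F)
      ≤ ENNReal.ofReal ((2 * n + 1) ^ V * (2 * Real.exp (n * (t ^ 2 / 2)))) := by
  set I := ∫⁻ z, ENNReal.ofReal (Real.exp (t * ghostSup 𝒮 (fun _ : Fin n => true) z))
        ∂(Measure.pi fun _ => F) with hI
  have hsum : (2 : ℝ≥0∞) ^ n * I
      = ∫⁻ z, ∑ σ : Fin n → Bool, ENNReal.ofReal (Real.exp (t * ghostSup 𝒮 σ z))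
          ∂(Measure.pi fun _ => F) := by
    rw [lintegral_finsetSum' _ fun σ _ => aemeasurable_exp_ghostSup hm σ t]
    rw [Finset.sum_congr rfl fun σ _ => lintegral_exp_ghostSup_eq σ t, Finset.sum_const,
      Finset.card_univ, nsmul_eq_mul]
    simp [← hI]
  have hle : (2 : ℝ≥0∞) ^ n * I
      ≤ 2 ^ n * ENNReal.ofReal ((2 * n + 1) ^ V * (2 * Real.exp (n * (t ^ 2 / 2)))) := by
    rw [hsum]
    calc _ ≤ ∫⁻ _z, ENNReal.ofReal
              (2 ^ n * ((2 * n + 1) ^ V * (2 * Real.exp (n * (t ^ 2 / 2)))))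
              ∂(Measure.pi fun _ : Fin n ⊕ Fin n => F) := by
          refine lintegral_mono fun z => ?_
          rw [← ENNReal.ofReal_sum_of_nonneg fun _ _ => (Real.exp_pos _).le]
          exact ENNReal.ofReal_le_ofReal (sum_exp_ghostSup_le hV z t)
      _ = _ := by
          rw [lintegral_const, measure_univ, mul_one, ENNReal.ofReal_mul (by positivity)]
          simp [ENNReal.ofReal_pow]
  exact (ENNReal.mul_le_mul_iff_right (by simp) (by simp)).1 hle

/-- Averaging over the ghost sample. -/
lemma exp_abs_sub_le_lintegral [IsProbabilityMeasure F] {n : ℕ} {t : ℝ} (ht : 0 ≤ t) {S : Set α}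
    (hS : S ∈ 𝒮) (hSm : MeasurableSet S) (x : Fin n → α) :
    ENNReal.ofReal (Real.exp (t * |∑ j, S.indicator (1 : α → ℝ) (x j) - n * F.real S|))
      ≤ ∫⁻ y, ENNReal.ofReal (Real.exp (t * ghostSup 𝒮 (fun _ : Fin n => true) (Sum.elim x y)))
          ∂(Measure.pi fun _ => F) := by
  let g : (Fin n → α) → ℝ := fun y =>
    ∑ j, S.indicator (1 : α → ℝ) (x j) - ∑ j, S.indicator (1 : α → ℝ) (y j)
  have hind : ∀ y : α, |S.indicator (1 : α → ℝ) y| ≤ 1 := fun y => by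
    by_cases h : y ∈ S <;> simp [h]
  have hmeas : Measurable g := by
    refine measurable_const.sub (Finset.measurable_sum _ fun j _ => ?_)
    exact (measurable_one.indicator hSm).comp (measurable_pi_apply j)
  have hbound : ∀ y, |g y| ≤ n + n := fun y => by
    have h : ∀ w : Fin n → α, |∑ j, S.indicator (1 : α → ℝ) (w j)| ≤ n := fun w =>
      (Finset.abs_sum_le_sum_abs _ _).trans ((Finset.sum_le_sum fun j _ => hind (w j)).trans
        (by simp))
    exact (abs_sub _ _).trans (add_le_add (h x) (h y))
  have hgi : Integrable g (Measure.pi fun _ => F) :=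
    Integrable.of_bound hmeas.aestronglyMeasurable (n + n) (Eventually.of_forall hbound)
  have hei : Integrable (fun y => Real.exp (t * |g y|)) (Measure.pi fun _ => F) := by
    refine Integrable.of_bound (by fun_prop) (Real.exp (t * (n + n)))
      (Eventually.of_forall fun y => ?_)
    rw [Real.norm_eq_abs, Real.abs_exp]
    exact Real.exp_le_exp.2 (mul_le_mul_of_nonneg_left (hbound y) ht)
  have hint : ∫ y, g y ∂(Measure.pi fun _ => F)
      = ∑ j, S.indicator (1 : α → ℝ) (x j) - n * F.real S := by
    have hone : ∀ j : Fin n, Integrable (fun y : Fin n → α => S.indicator (1 : α → ℝ) (y j))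
        (Measure.pi fun _ => F) := fun j =>
      Integrable.of_bound ((measurable_one.indicator hSm).comp
        (measurable_pi_apply j)).aestronglyMeasurable 1 (Eventually.of_forall fun y => hind (y j))
    simp only [g]
    rw [integral_sub (integrable_const _) (integrable_finsetSum _ fun j _ => hone j),
      integral_finsetSum _ fun j _ => hone j]
    have : ∀ j : Fin n, ∫ y : Fin n → α, S.indicator (1 : α → ℝ) (y j) ∂(Measure.pi fun _ => F)
        = F.real S := fun j => by
      rw [integral_comp_eval (μ := fun _ : Fin n => F) (i := j)
        (measurable_one.indicator hSm).aestronglyMeasurable, integral_indicator_one hSm]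
    simp [this]
  -- The deviation is the mean of `g` over the ghost sample; Jensen is applied to the absolute value
  -- and then to the exponential.
  have hjensen : Real.exp (t * |∑ j, S.indicator (1 : α → ℝ) (x j) - n * F.real S|)
      ≤ ∫ y, Real.exp (t * |g y|) ∂(Measure.pi fun _ => F) := by
    rw [← hint]
    calc Real.exp (t * |∫ y, g y ∂(Measure.pi fun _ => F)|)
        ≤ Real.exp (∫ y, t * |g y| ∂(Measure.pi fun _ => F)) := by
          rw [integral_const_mul]
          exact Real.exp_le_exp.2 (mul_le_mul_of_nonneg_left (abs_integral_le_integral_abs) ht)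
      _ ≤ _ := convexOn_exp.map_integral_le Real.continuous_exp.continuousOn isClosed_univ
          (by simp) (hgi.abs.const_mul t) hei
  refine (ENNReal.ofReal_le_ofReal hjensen).trans ?_
  rw [ofReal_integral_eq_lintegral_ofReal hei (Eventually.of_forall fun _ => (Real.exp_pos _).le)]
  refine lintegral_mono fun y => ENNReal.ofReal_le_ofReal (Real.exp_le_exp.2
    (mul_le_mul_of_nonneg_left ?_ ht))
  refine le_trans (le_of_eq ?_) (le_ciSup (bddAbove_ghost _ _) ⟨S, hS⟩)
  simp [g, ghostSign, boolSign, Fintype.sum_sum_type, sub_eq_add_neg]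

/-- The **Vapnik-Chervonenkis inequality**, for the outer measure of the deviation event. -/
theorem measure_deviation_le [IsProbabilityMeasure F] (hV : HasVCDim 𝒮 V)
    (hS : ∀ S ∈ 𝒮, MeasurableSet S) (hm : IsMeasurableClass 𝒮 F) (n : ℕ) {t : ℝ} (ht : 0 ≤ t) :
    (Measure.pi fun _ : Fin n => F)
        {x | ∃ S ∈ 𝒮, n * t < |∑ j, S.indicator (1 : α → ℝ) (x j) - n * F.real S|}
      ≤ ENNReal.ofReal ((2 * n + 1) ^ V * (2 * Real.exp (-(n * (t ^ 2 / 2))))) := by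
  let G : (Fin n → α) × (Fin n → α) → ℝ≥0∞ := fun p =>
    ENNReal.ofReal (Real.exp (t * ghostSup 𝒮 (fun _ : Fin n => true) (Sum.elim p.1 p.2)))
  let H : (Fin n → α) → ℝ≥0∞ := fun x => ∫⁻ y, G (x, y) ∂(Measure.pi fun _ => F)
  have hmp := measurePreserving_sumPiEquivProdPi_symm (ι := Fin n) (ι' := Fin n)
    (X := fun _ => α) fun _ => F
  have hcomp : ∀ p : (Fin n → α) × (Fin n → α),
      (MeasurableEquiv.sumPiEquivProdPi fun _ : Fin n ⊕ Fin n => α).symm p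
        = Sum.elim p.1 p.2 := fun p => by
    funext k; cases k <;> rfl
  have hG : AEMeasurable G ((Measure.pi fun _ => F).prod (Measure.pi fun _ => F)) := by
    refine ((aemeasurable_exp_ghostSup hm (fun _ : Fin n => true)
      t).comp_quasiMeasurePreserving hmp.quasiMeasurePreserving).congr
      (Eventually.of_forall fun p => ?_)
    simp only [Function.comp, hcomp, G]
  have hHint : ∫⁻ x, H x ∂(Measure.pi fun _ => F)
      ≤ ENNReal.ofReal ((2 * n + 1) ^ V * (2 * Real.exp (n * (t ^ 2 / 2)))) := by
    refine le_trans (le_of_eq ?_) (lintegral_exp_ghostSup_le hV hm n t)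
    rw [hmp.lintegral_map_equiv]
    simp only [hcomp]
    exact (lintegral_prod G hG).symm
  -- The exponential parameter is `t` itself, the minimizer of `n s² / 2 - s n t` over `s`. Markov
  -- is applied to `H`, which is a.e. measurable, whereas the deviation event inside its superlevel
  -- set need not be.
  have hmarkov := mul_meas_ge_le_lintegral₀ hG.lintegral_prod_right'
    (ENNReal.ofReal (Real.exp (n * t ^ 2)))
  have hsub : {x : Fin n → α | ∃ S ∈ 𝒮,
      n * t < |∑ j, S.indicator (1 : α → ℝ) (x j) - n * F.real S|}
      ⊆ {x | ENNReal.ofReal (Real.exp (n * t ^ 2)) ≤ H x} := by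
    rintro x ⟨S, hSm, hlt⟩
    refine le_trans (ENNReal.ofReal_le_ofReal (Real.exp_le_exp.2 ?_))
      (exp_abs_sub_le_lintegral ht hSm (hS S hSm) x)
    calc (n : ℝ) * t ^ 2 = t * (n * t) := by ring
      _ ≤ _ := mul_le_mul_of_nonneg_left hlt.le ht
  refine (measure_mono hsub).trans ?_
  have hpos : ENNReal.ofReal (Real.exp (n * t ^ 2)) ≠ 0 := by simp [Real.exp_pos]
  refine (ENNReal.mul_le_mul_iff_right hpos ENNReal.ofReal_ne_top).1
    ((hmarkov.trans hHint).trans (le_of_eq ?_))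
  rw [← ENNReal.ofReal_mul (Real.exp_pos _).le]
  congr 1
  have : Real.exp (n * (t ^ 2 / 2)) = Real.exp (n * t ^ 2) * Real.exp (-(n * (t ^ 2 / 2))) := by
    rw [← Real.exp_add]; congr 1; ring
  rw [this]; ring

end VC

/-! ### Confidence radii -/

lemma epsRadius_arg_eq {V n : ℕ} :
    (V * Real.log (n + 1) - Real.log ((1 / n : ℝ) / 2)) / n
      = (V * Real.log (n + 1) + Real.log (2 * n)) / n := by
  rw [div_div, one_div, Real.log_inv, mul_comm (n : ℝ) 2, sub_neg_eq_add]

lemma epsRadius_arg_pos {V n : ℕ} (hn : 1 ≤ n) :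
    0 < V * Real.log (n + 1) + Real.log (2 * n) := by
  have h1 : (1 : ℝ) ≤ n := by exact_mod_cast hn
  have h2 : 0 ≤ Real.log ((n : ℝ) + 1) := Real.log_nonneg (by linarith)
  have h3 : 0 < Real.log (2 * (n : ℝ)) := Real.log_pos (by linarith)
  positivity

lemma epsRadius_pos {V n : ℕ} (hn : 1 ≤ n) : 0 < epsRadius V n (1 / n) := by
  have hn' : (0 : ℝ) < n := by exact_mod_cast hn
  rw [epsRadius, epsRadius_arg_eq]
  have := epsRadius_arg_pos (V := V) hn
  positivity

lemma mul_epsRadius_sq {V n : ℕ} (hn : 1 ≤ n) :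
    n * (epsRadius V n (1 / n) ^ 2 / 2)
      = 9 / 2 * (V * Real.log (n + 1) + Real.log (2 * n)) := by
  have hn' : (0 : ℝ) < n := by exact_mod_cast hn
  have := epsRadius_arg_pos (V := V) hn
  rw [epsRadius, epsRadius_arg_eq, mul_pow, Real.sq_sqrt (by positivity)]
  field_simp
  ring

lemma tendsto_epsRadius (V : ℕ) :
    Tendsto (fun n : ℕ => epsRadius V n (1 / n)) atTop (nhds 0) := by
  have hc : Tendsto (fun n : ℕ => (n : ℝ) + 1) atTop atTop :=
    tendsto_atTop_add_const_right _ _ tendsto_natCast_atTop_atTop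
  have hd : Tendsto (fun n : ℕ => 2 * (n : ℝ)) atTop atTop :=
    tendsto_natCast_atTop_atTop.const_mul_atTop two_pos
  have h1 : Tendsto (fun n : ℕ => Real.log (n + 1) / n) atTop (nhds 0) := by
    refine ((Real.tendsto_pow_log_div_mul_add_atTop 1 (-1) 1 one_ne_zero).comp hc).congr
      fun n => ?_
    simp
  have h2 : Tendsto (fun n : ℕ => Real.log (2 * n) / n) atTop (nhds 0) := by
    have := (Real.tendsto_pow_log_div_mul_add_atTop (1 / 2) 0 1 (by norm_num)).comp hd
    refine this.congr fun n => ?_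
    simp only [Function.comp, pow_one, add_zero]
    congr 1
    ring
  have h3 : Tendsto (fun n : ℕ => 3 * Real.sqrt (V * (Real.log (n + 1) / n)
      + Real.log (2 * n) / n)) atTop (nhds 0) := by
    simpa using (((h1.const_mul (V : ℝ)).add h2).sqrt).const_mul 3
  refine h3.congr' ?_
  filter_upwards [eventually_ge_atTop 1] with n hn
  rw [epsRadius, epsRadius_arg_eq]
  congr 2
  ring

/-- Uniform deviations of the empirical distribution exceed the confidence radius with small
probability. -/
theorem measure_empirical_deviation_le {α Ω : Type*} [MeasurableSpace α] [MeasurableSpace Ω]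
    {𝒮 : Set (Set α)} {V : ℕ} {F : Measure α} [IsProbabilityMeasure F] (hV : HasVCDim 𝒮 V)
    (hS : ∀ S ∈ 𝒮, MeasurableSet S) (hm : IsMeasurableClass 𝒮 F)
    {Pr : Measure Ω} [IsProbabilityMeasure Pr] {X : ℕ → Ω → α} (hlaw : ∀ j, HasLaw (X j) F Pr)
    (hindep : iIndepFun X Pr) {n : ℕ} (hn : 1 ≤ n) :
    Pr {ω | ∃ S ∈ 𝒮, epsRadius V n (1 / n) < |empirical (fun j => X j ω) n S - F.real S|}
      ≤ ENNReal.ofReal (2 ^ V / n) := by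
  have hn' : (0 : ℝ) < n := by exact_mod_cast hn
  set t := epsRadius V n (1 / n) with ht
  have hmap : Pr.map (fun ω (j : Fin n) => X j ω) = Measure.pi fun _ => F := by
    rw [(iIndepFun_iff_map_fun_eq_pi_map fun j : Fin n => (hlaw j).aemeasurable).1
      (hindep.precomp Fin.val_injective)]
    congr 1
    funext j
    exact (hlaw j).map_eq
  have hXm : AEMeasurable (fun ω (j : Fin n) => X j ω) Pr :=
    aemeasurable_pi_lambda _ fun j => (hlaw j).aemeasurable
  have hsub : {ω | ∃ S ∈ 𝒮, t < |empirical (fun j => X j ω) n S - F.real S|}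
      ⊆ (fun ω (j : Fin n) => X j ω) ⁻¹' {x | ∃ S ∈ 𝒮,
        n * t < |∑ j, S.indicator (1 : α → ℝ) (x j) - n * F.real S|} := by
    rintro ω ⟨S, hSm, hlt⟩
    refine ⟨S, hSm, ?_⟩
    have : ∑ j : Fin n, S.indicator (1 : α → ℝ) (X j ω) - n * F.real S
        = n * (empirical (fun j => X j ω) n S - F.real S) := by
      rw [empirical, Finset.sum_range]
      field_simp
    rw [this, abs_mul, Nat.abs_cast]
    exact mul_lt_mul_of_pos_left hlt hn'
  -- Only an inequality is available, and needed, as the event may fail to be measurable.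
  refine (measure_mono hsub).trans ((Measure.le_map_apply hXm _).trans ?_)
  rw [hmap]
  refine (measure_deviation_le hV hS hm n (epsRadius_pos hn).le).trans
    (ENNReal.ofReal_le_ofReal ?_)
  rw [mul_epsRadius_sq hn]
  have hpos := epsRadius_arg_pos (V := V) hn
  -- The factor `9 / 2` exceeds what is needed: with `1` in its place, `(n + 1) ^ V` already absorbs
  -- the number of traces up to `2 ^ V`, and `2 n` leaves the decay `1 / n`.
  have hexp : Real.exp (-(9 / 2 * (V * Real.log (n + 1) + Real.log (2 * n))))
      ≤ (((n : ℝ) + 1) ^ V * (2 * n))⁻¹ := by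
    calc _ ≤ Real.exp (-(V * Real.log (n + 1) + Real.log (2 * n))) :=
          Real.exp_le_exp.2 (by linarith)
      _ = _ := by
        rw [Real.exp_neg, Real.exp_add, Real.exp_log (by positivity), Real.exp_nat_mul,
          Real.exp_log (by positivity)]
  have hpow : (2 * (n : ℝ) + 1) ^ V ≤ 2 ^ V * ((n : ℝ) + 1) ^ V := by
    rw [← mul_pow]
    gcongr
    linarith
  calc (2 * (n : ℝ) + 1) ^ V * (2 * Real.exp (-(9 / 2 * (V * Real.log (n + 1)
        + Real.log (2 * n)))))
      ≤ (2 ^ V * ((n : ℝ) + 1) ^ V) * (2 * (((n : ℝ) + 1) ^ V * (2 * n))⁻¹) := by gcongr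
    _ = 2 ^ V / n := by field_simp

/-! ### Comparison of measures on rich classes of sets -/

/-- Outer regularity of `μ` reduces every set to its open neighbourhoods. -/
lemma measure_le_of_isOpen_le {E : Type*} [PseudoMetricSpace E] [MeasurableSpace E] [BorelSpace E]
    {ρ μ : Measure E} [IsFiniteMeasure μ] (h : ∀ U, IsOpen U → ρ U ≤ μ U) : ρ ≤ μ := by
  intro A
  rw [Set.measure_eq_iInf_isOpen A μ]
  exact le_iInf₂ fun U hAU => le_iInf fun hU => (measure_mono hAU).trans (h U hU)

/-- The Besicovitch covering uses closed balls, which are decreasing intersections of open ones. -/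
lemma measure_closedBall_le_of_ball_le {E : Type*} [PseudoMetricSpace E] [MeasurableSpace E]
    [BorelSpace E] {ρ μ : Measure E} [IsFiniteMeasure μ]
    (h : ∀ x r, 0 < r → ρ (Metric.ball x r) ≤ μ (Metric.ball x r)) (x : E) {r : ℝ} (hr : 0 ≤ r) :
    ρ (Metric.closedBall x r) ≤ μ (Metric.closedBall x r) := by
  have hpos : ∀ k : ℕ, (0 : ℝ) < 1 / (k + 1) := fun k => Nat.one_div_pos_of_nat
  have hset : Metric.closedBall x r = ⋂ k : ℕ, Metric.ball x (r + 1 / (k + 1)) := by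
    ext y
    simp only [Metric.mem_closedBall, Set.mem_iInter, Metric.mem_ball]
    refine ⟨fun hy k => lt_of_le_of_lt hy (lt_add_of_pos_right _ (hpos k)), fun hy => ?_⟩
    refine le_of_forall_pos_lt_add fun ε hε => ?_
    obtain ⟨k, hk⟩ := exists_nat_one_div_lt hε
    exact (hy k).trans (by linarith)
  have hanti : Antitone fun k : ℕ => Metric.ball x (r + 1 / ((k : ℝ) + 1)) := fun a b hab =>
    Metric.ball_subset_ball (by gcongr)
  have hlim : Tendsto (fun k : ℕ => μ (Metric.ball x (r + 1 / ((k : ℝ) + 1)))) atTop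
      (nhds (μ (Metric.closedBall x r))) := by
    rw [hset]
    exact tendsto_measure_iInter_atTop (fun k => Metric.isOpen_ball.nullMeasurableSet) hanti
      ⟨0, measure_ne_top _ _⟩
  refine ge_of_tendsto' hlim fun k => le_trans (measure_mono ?_) (h x _ (by linarith [hpos k]))
  rw [hset]
  exact Set.iInter_subset _ k

/-- Open balls determine the order on finite measures, by the Besicovitch covering theorem. -/
lemma measure_le_of_ball_le {E : Type*} [MetricSpace E] [SecondCountableTopology E]
    [HasBesicovitchCovering E] [MeasurableSpace E] [BorelSpace E] {ρ μ : Measure E}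
    [IsFiniteMeasure ρ] [IsFiniteMeasure μ]
    (h : ∀ x r, 0 < r → ρ (Metric.ball x r) ≤ μ (Metric.ball x r)) : ρ ≤ μ := by
  refine measure_le_of_isOpen_le fun U hU => ?_
  obtain ⟨t, r, htc, -, hr, hnull, hdisj⟩ := Besicovitch.exists_disjoint_closedBall_covering_ae ρ
    (fun x => {r | Metric.closedBall x r ⊆ U}) U
    (fun x hx δ hδ => by
      obtain ⟨ε, hε, hεU⟩ := Metric.nhds_basis_closedBall.mem_iff.1 (hU.mem_nhds hx)
      refine ⟨min ε (δ / 2), (Metric.closedBall_subset_closedBall (min_le_left _ _)).trans hεU,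
        lt_min hε (half_pos hδ), (min_le_right _ _).trans_lt (half_lt_self hδ)⟩)
    (fun _ => 1) fun _ _ => one_pos
  have hmeas : ∀ x ∈ t, MeasurableSet (Metric.closedBall x (r x)) := fun x _ =>
    measurableSet_closedBall
  calc ρ U ≤ ρ (U \ ⋃ x ∈ t, Metric.closedBall x (r x)) + ρ (⋃ x ∈ t, Metric.closedBall x (r x)) :=
        (measure_mono (by rw [Set.sdiff_union_self]; exact Set.subset_union_left)).trans
          (measure_union_le _ _)
    _ = ∑' x : t, ρ (Metric.closedBall (x : E) (r x)) := by
        rw [hnull, zero_add, measure_biUnion htc hdisj hmeas]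
    _ ≤ ∑' x : t, μ (Metric.closedBall (x : E) (r x)) :=
        ENNReal.tsum_le_tsum fun x =>
          measure_closedBall_le_of_ball_le h _ (hr x x.2).2.1.le
    _ = μ (⋃ x ∈ t, Metric.closedBall x (r x)) := (measure_biUnion htc hdisj hmeas).symm
    _ ≤ μ U := measure_mono (Set.iUnion₂_subset fun x hx => (hr x hx).1)

/-- Open cubes are the balls of the sup metric, so the ball criterion applies after transport to
`Fin d → ℝ`. -/
lemma measure_le_of_openRectangle_le {d : ℕ} {ρ μ : Measure (Space d)} [IsFiniteMeasure ρ]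
    [IsFiniteMeasure μ] (h : ∀ S ∈ openRectangles d, ρ S ≤ μ S) : ρ ≤ μ := by
  let e : Space d ≃ᵐ (Fin d → ℝ) := (MeasurableEquiv.toLp 2 (Fin d → ℝ)).symm
  have hmap : ρ.map e ≤ μ.map e := by
    refine measure_le_of_ball_le fun x r hr => ?_
    rw [e.map_apply, e.map_apply]
    refine h _ ⟨fun k => x k - r, fun k => x k + r, fun k => by linarith, ?_⟩
    ext y
    rw [Set.mem_preimage, ball_pi x hr, Set.mem_univ_pi]
    refine forall_congr' fun k => ?_
    rw [Metric.mem_ball, Real.dist_eq, abs_lt]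
    change -r < y k - x k ∧ y k - x k < r ↔ _
    constructor <;> rintro ⟨h1, h2⟩ <;> constructor <;> linarith
  intro A
  have := hmap (e '' A)
  rwa [e.map_apply, e.map_apply, e.injective.preimage_image] at this

lemma PacksOpenSets.measure_le {d : ℕ} {𝒢 : Set (Set (Space d))} (h𝒢 : PacksOpenSets 𝒢)
    (hm : ∀ S ∈ 𝒢, MeasurableSet S) {ρ μ : Measure (Space d)} [IsFiniteMeasure ρ]
    [IsFiniteMeasure μ] (h : ∀ S ∈ 𝒢, ρ S ≤ μ S) : ρ ≤ μ := by
  rcases eq_or_ne ρ 0 with rfl | hρ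
  · exact Measure.zero_le _
  refine measure_le_of_isOpen_le fun U hU => ?_
  have : NeZero ρ := ⟨hρ⟩
  -- The packing may depend on the distribution; it is taken for the normalized smaller measure,
  -- whose lost mass must vanish.
  obtain ⟨𝒯, h𝒯, hc, hd, hsub, hnull⟩ := h𝒢 ((ρ Set.univ)⁻¹ • ρ) inferInstance U hU
  have hnull' : ρ (U \ ⋃₀ 𝒯) = 0 := by
    simpa [measure_ne_top] using hnull
  have hmeas : ∀ S ∈ 𝒯, MeasurableSet S := fun S hS => hm S (h𝒯 hS)
  calc ρ U ≤ ρ (U \ ⋃₀ 𝒯) + ρ (⋃₀ 𝒯) :=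
        (measure_mono (by rw [Set.sdiff_union_self]; exact Set.subset_union_left)).trans
          (measure_union_le _ _)
    _ = ∑' S : 𝒯, ρ S := by rw [hnull', zero_add, measure_sUnion hc hd hmeas]
    _ ≤ ∑' S : 𝒯, μ S := ENNReal.tsum_le_tsum fun S => h S (h𝒯 S.2)
    _ = μ (⋃₀ 𝒯) := (measure_sUnion hc hd hmeas).symm
    _ ≤ μ U := measure_mono (Set.sUnion_subset hsub)

/-- A rich class of sets determines the order on finite measures. -/
theorem IsRich.measure_le {d : ℕ} {𝒮 : Set (Set (Space d))} (h𝒮 : IsRich 𝒮)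
    (hm : ∀ S ∈ 𝒮, MeasurableSet S) {ρ μ : Measure (Space d)} [IsFiniteMeasure ρ]
    [IsFiniteMeasure μ] (h : ∀ S ∈ 𝒮, ρ S ≤ μ S) : ρ ≤ μ := by
  rcases h𝒮 with hb | hr | ⟨𝒢, h𝒢𝒮, h𝒢⟩
  · exact measure_le_of_ball_le fun x r hr => h _ (hb ⟨x, r, hr, rfl⟩)
  · exact measure_le_of_openRectangle_le fun S hS => h S (hr hS)
  · exact h𝒢.measure_le (fun S hS => hm S (h𝒢𝒮 hS)) fun S hS => h S (h𝒢𝒮 hS)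

/-! ### Identifiability -/

section Identifiability

variable {α : Type*} [MeasurableSpace α] {L : ℕ}

lemma real_sum_ofReal_smul {ι : Type*} [Fintype ι] (P : ι → Measure α)
    [∀ k, IsFiniteMeasure (P k)] {c : ι → ℝ} (hc : ∀ k, 0 ≤ c k) (A : Set α) :
    (∑ k, ENNReal.ofReal (c k) • P k).real A = ∑ k, c k * (P k).real A := by
  simp only [measureReal_def, Measure.coe_finsetSum, Finset.sum_apply, Measure.smul_apply,
    smul_eq_mul]
  rw [ENNReal.toReal_sum fun k _ => ENNReal.mul_ne_top ENNReal.ofReal_ne_top (measure_ne_top _ _)]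
  exact Finset.sum_congr rfl fun k _ => by
    rw [ENNReal.toReal_mul, ENNReal.toReal_ofReal (hc k)]

lemma isFiniteMeasure_sum_ofReal_smul {ι : Type*} [Fintype ι] (P : ι → Measure α)
    [∀ k, IsFiniteMeasure (P k)] (c : ι → ℝ) :
    IsFiniteMeasure (∑ k, ENNReal.ofReal (c k) • P k) := by
  refine ⟨?_⟩
  simp only [Measure.coe_finsetSum, Finset.sum_apply, Measure.smul_apply, smul_eq_mul]
  exact ENNReal.sum_lt_top.2 fun k _ =>
    ENNReal.mul_lt_top ENNReal.ofReal_lt_top (measure_lt_top _ _)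

/-- A setwise nonnegative linear combination of finite measures is a measure. -/
lemma exists_measure_real_eq_sum {ι : Type*} [Fintype ι] (P : ι → Measure α)
    [∀ k, IsFiniteMeasure (P k)] {c : ι → ℝ}
    (hc : ∀ A, MeasurableSet A → 0 ≤ ∑ k, c k * (P k).real A) :
    ∃ Q : Measure α, IsFiniteMeasure Q ∧
      ∀ A, MeasurableSet A → Q.real A = ∑ k, c k * (P k).real A := by
  let μp := ∑ k, ENNReal.ofReal (max (c k) 0) • P k
  let μm := ∑ k, ENNReal.ofReal (max (-c k) 0) • P k
  have hp : IsFiniteMeasure μp := isFiniteMeasure_sum_ofReal_smul _ _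
  have hm : IsFiniteMeasure μm := isFiniteMeasure_sum_ofReal_smul _ _
  have hsub : ∀ A, μp.real A - μm.real A = ∑ k, c k * (P k).real A := fun A => by
    simp only [μp, μm]
    rw [real_sum_ofReal_smul P (fun k => le_max_right _ _),
      real_sum_ofReal_smul P (fun k => le_max_right _ _), ← Finset.sum_sub_distrib]
    refine Finset.sum_congr rfl fun k _ => ?_
    rw [← sub_mul, max_zero_sub_max_neg_zero_eq_self]
  have hle : μm ≤ μp := Measure.le_iff.2 fun A hA => by
    have h := hc A hA
    rw [← hsub, sub_nonneg, measureReal_def, measureReal_def] at h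
    exact (ENNReal.toReal_le_toReal (measure_ne_top _ _) (measure_ne_top _ _)).1 h
  refine ⟨μp - μm, inferInstance, fun A hA => ?_⟩
  rw [← hsub, measureReal_def, Measure.sub_apply hA hle,
    ENNReal.toReal_sub_of_le (hle A) (measure_ne_top _ _), measureReal_def, measureReal_def]

/-- Under joint irreducibility, setwise nonnegative linear combinations have nonnegative
coefficients. -/
lemma JointlyIrreducible.nonneg {P : Fin L → Measure α} (hirr : JointlyIrreducible P)
    [∀ k, IsProbabilityMeasure (P k)] {c : Fin L → ℝ}
    (hc : ∀ A, MeasurableSet A → 0 ≤ ∑ k, c k * (P k).real A) (k : Fin L) : 0 ≤ c k := by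
  by_contra! hneg
  -- With this `t`, the nonnegative set function `P_k + t ∑ c_j P_j` has `k`-th coefficient `1 + t
  -- c_k = -1`; dividing by its mass `D` contradicts irreducibility.
  let t := 2 / (-c k)
  have ht : 0 < t := div_pos two_pos (neg_pos.2 hneg)
  have hC : 0 ≤ ∑ j, c j := by simpa using hc Set.univ MeasurableSet.univ
  let D := 1 + t * ∑ j, c j
  have hD : 0 < D := by positivity
  let γ : Fin L → ℝ := fun j => ((Pi.single k 1 : Fin L → ℝ) j + t * c j) / D
  have hγ : ∀ A, ∑ j, γ j * (P j).real A
      = ((P k).real A + t * ∑ j, c j * (P j).real A) / D := fun A => by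
    have : ∀ j, γ j * (P j).real A
        = ((Pi.single k 1 : Fin L → ℝ) j * (P j).real A + t * (c j * (P j).real A)) / D :=
      fun j => by simp only [γ]; ring
    simp_rw [this]
    rw [← Finset.sum_div, Finset.sum_add_distrib, ← Finset.mul_sum]
    simp [Pi.single_apply]
  obtain ⟨Q, hQf, hQ⟩ := exists_measure_real_eq_sum P (c := γ) fun A hA => by
    rw [hγ]
    have := hc A hA
    positivity
  have hQ1 : IsProbabilityMeasure Q := by
    refine ⟨?_⟩
    have h := hQ Set.univ MeasurableSet.univ
    rw [hγ] at h
    simp only [probReal_univ, mul_one] at h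
    rw [show (1 + t * ∑ j, c j) / D = 1 from div_self hD.ne'] at h
    rwa [measureReal_def, ENNReal.toReal_eq_one_iff] at h
  have h := hirr γ Q hQ1 hQ k
  have h1 : γ k = -1 / D := by
    simp only [γ, t, Pi.single_eq_same]
    congr 1
    field_simp [hneg.ne]
    norm_num
  rw [h1] at h
  exact absurd h (not_le.2 (div_neg_of_neg_of_pos (by norm_num) hD))

/-- The proportion of the other contaminated distributions in the `i`-th one. -/
def kappaStar (M : Matrix (Fin L) (Fin L) ℝ) (i : Fin L) : ℝ := 1 - 1 / M⁻¹ i i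

/-- The weights of the other contaminated distributions in the `i`-th one. -/
def nuStar (M : Matrix (Fin L) (Fin L) ℝ) (i : Fin L) (j : {j : Fin L // j ≠ i}) : ℝ :=
  -M⁻¹ i j / M⁻¹ i i

variable {M : Matrix (Fin L) (Fin L) ℝ}

lemma LowNoise.isUnit_det (hB : LowNoise M) : IsUnit M.det := (Matrix.isUnit_iff_isUnit_det M).1 hB.1

lemma nuStar_nonneg (hB : LowNoise M) (i : Fin L) (j : {j : Fin L // j ≠ i}) :
    0 ≤ nuStar M i j :=
  div_nonneg (neg_nonneg.2 (hB.2.2 i j j.2.symm)) (hB.2.1 i).le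

lemma sum_inv_row (hM : M ∈ Matrix.rowStochastic ℝ (Fin L)) (hB : LowNoise M) (i : Fin L) :
    ∑ j, M⁻¹ i j = 1 := by
  have h : M⁻¹.mulVec 1 = 1 := by
    nth_rewrite 1 [← hM.2]
    rw [Matrix.mulVec_mulVec, Matrix.nonsing_inv_mul _ hB.isUnit_det, Matrix.one_mulVec]
  simpa [Matrix.mulVec, dotProduct] using congrFun h i

lemma sum_nuStar (hM : M ∈ Matrix.rowStochastic ℝ (Fin L)) (hB : LowNoise M) (i : Fin L) :
    ∑ j, nuStar M i j = kappaStar M i := by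
  have h := Fintype.sum_eq_add_sum_subtype_ne (fun j => M⁻¹ i j) i
  rw [sum_inv_row hM hB] at h
  have hpos := hB.2.1 i
  simp only [nuStar, kappaStar]
  rw [← Finset.sum_div, Finset.sum_neg_distrib]
  field_simp
  linarith

lemma kappaStar_nonneg (hM : M ∈ Matrix.rowStochastic ℝ (Fin L)) (hB : LowNoise M) (i : Fin L) :
    0 ≤ kappaStar M i := by
  rw [← sum_nuStar hM hB]
  exact Finset.sum_nonneg fun j _ => nuStar_nonneg hB i j

lemma kappaStar_lt_one (hB : LowNoise M) (i : Fin L) : kappaStar M i < 1 := by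
  have := hB.2.1 i
  rw [kappaStar, sub_lt_self_iff]
  positivity

variable {P : Fin L → Measure α} [∀ k, IsProbabilityMeasure (P k)]

lemma contaminated_real (hM : M ∈ Matrix.rowStochastic ℝ (Fin L)) (i : Fin L) (A : Set α) :
    (contaminated M P i).real A = ∑ k, M i k * (P k).real A :=
  real_sum_ofReal_smul P (fun k => hM.1 i k) A

lemma isProbabilityMeasure_contaminated (hM : M ∈ Matrix.rowStochastic ℝ (Fin L)) (i : Fin L) :
    IsProbabilityMeasure (contaminated M P i) := by
  have h := contaminated_real (P := P) hM i Set.univ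
  simp only [probReal_univ, mul_one, Matrix.sum_row_of_mem_rowStochastic hM] at h
  exact ⟨by rwa [measureReal_def, ENNReal.toReal_eq_one_iff] at h⟩

/-- The `i`-th base distribution is the residue of the `i`-th contaminated one. -/
lemma contaminated_sub_sum_nuStar (hM : M ∈ Matrix.rowStochastic ℝ (Fin L)) (hB : LowNoise M)
    (i : Fin L) (A : Set α) :
    (contaminated M P i).real A
        - ∑ j : {j : Fin L // j ≠ i}, nuStar M i j * (contaminated M P j).real A
      = (1 - kappaStar M i) * (P i).real A := by
  have hpos := hB.2.1 i
  have h := Fintype.sum_eq_add_sum_subtype_ne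
    (fun j => M⁻¹ i j * (contaminated M P j).real A) i
  have hinv : ∑ j, M⁻¹ i j * (contaminated M P j).real A = (P i).real A := by
    simp_rw [contaminated_real hM, Finset.mul_sum]
    rw [Finset.sum_comm]
    have : ∀ k, ∑ j, M⁻¹ i j * (M j k * (P k).real A)
        = (1 : Matrix (Fin L) (Fin L) ℝ) i k * (P k).real A := fun k => by
      rw [← Matrix.nonsing_inv_mul M hB.isUnit_det, Matrix.mul_apply, Finset.sum_mul]
      exact Finset.sum_congr rfl fun j _ => by ring
    simp [this, Matrix.one_apply]
  rw [hinv] at h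
  have hs : ∑ j : {j : Fin L // j ≠ i}, nuStar M i j * (contaminated M P j).real A
      = -(∑ j : {j : Fin L // j ≠ i}, M⁻¹ i j * (contaminated M P j).real A) / M⁻¹ i i := by
    rw [← Finset.sum_neg_distrib, Finset.sum_div]
    exact Finset.sum_congr rfl fun j _ => by rw [nuStar]; ring
  rw [hs, kappaStar, h]
  field_simp
  ring

lemma sum_nuStar_mul_le (hM : M ∈ Matrix.rowStochastic ℝ (Fin L)) (hB : LowNoise M)
    (i : Fin L) (A : Set α) :
    ∑ j : {j : Fin L // j ≠ i}, nuStar M i j * (contaminated M P j).real A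
      ≤ (contaminated M P i).real A := by
  have h := contaminated_sub_sum_nuStar (P := P) hM hB i A
  have := mul_nonneg (sub_nonneg.2 (kappaStar_lt_one hB i).le)
    (measureReal_nonneg (μ := P i) (s := A))
  linarith

/-- The maximal weights of the other contaminated distributions inside the `i`-th one are
unique. -/
theorem JointlyIrreducible.eq_nuStar (hirr : JointlyIrreducible P)
    (hM : M ∈ Matrix.rowStochastic ℝ (Fin L)) (hB : LowNoise M) (i : Fin L)
    {ν : {j : Fin L // j ≠ i} → ℝ} (hκ : kappaStar M i ≤ ∑ j, ν j)
    (hle : ∀ A, MeasurableSet A →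
      ∑ j, ν j * (contaminated M P j).real A ≤ (contaminated M P i).real A) :
    ν = nuStar M i := by
  -- `w` holds the coefficients of the residue in the contaminated laws, and `c = w M` those in the
  -- base laws, which irreducibility makes nonnegative.
  let w : Fin L → ℝ := fun j => if h : j = i then 1 else -ν ⟨j, h⟩
  have hwi : w i = 1 := by simp [w]
  have hwj : ∀ j : {j : Fin L // j ≠ i}, w j = -ν j := fun j => by simp [w, j.2]
  let c : Fin L → ℝ := Matrix.vecMul w M
  have hcsum : ∀ A, ∑ k, c k * (P k).real A = ∑ j, w j * (contaminated M P j).real A := by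
    intro A
    simp_rw [contaminated_real hM, Finset.mul_sum]
    rw [Finset.sum_comm]
    refine Finset.sum_congr rfl fun k _ => ?_
    simp only [c, Matrix.vecMul, dotProduct, Finset.sum_mul]
    exact Finset.sum_congr rfl fun j _ => by ring
  have hw : ∀ A, ∑ j, w j * (contaminated M P j).real A
      = (contaminated M P i).real A - ∑ j, ν j * (contaminated M P j).real A := by
    intro A
    rw [Fintype.sum_eq_add_sum_subtype_ne _ i, hwi, one_mul, sub_eq_add_neg,
      ← Finset.sum_neg_distrib]
    congr 1
    exact Finset.sum_congr rfl fun j _ => by rw [hwj]; ring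
  have hc : ∀ k, 0 ≤ c k := hirr.nonneg fun A hA => by
    rw [hcsum, hw]
    linarith [hle A hA]
  have hctot : ∑ k, c k = 1 - ∑ j, ν j := by
    have h1 := hcsum Set.univ
    have := fun j => isProbabilityMeasure_contaminated (P := P) hM j
    rw [hw] at h1
    simpa using h1
  have hcM : Matrix.vecMul c M⁻¹ = w := by
    rw [Matrix.vecMul_vecMul, Matrix.mul_nonsing_inv _ hB.isUnit_det, Matrix.vecMul_one]
  have hpos := hB.2.1 i
  have hcoord : ∀ j, w j = c i * M⁻¹ i j + ∑ k : {k : Fin L // k ≠ i}, c k * M⁻¹ k j := by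
    intro j
    rw [← Fintype.sum_eq_add_sum_subtype_ne (fun k => c k * M⁻¹ k j) i, ← hcM]
    rfl
  have hrest : ∑ k : {k : Fin L // k ≠ i}, c k * M⁻¹ k i ≤ 0 :=
    Finset.sum_nonpos fun k _ => mul_nonpos_of_nonneg_of_nonpos (hc k) (hB.2.2 k i k.2)
  have hsplit := Fintype.sum_eq_add_sum_subtype_ne c i
  -- Coordinate `i` of `w = c M⁻¹` reads `1 = c_i M⁻¹_ii` plus nonpositive terms. The total mass of
  -- `c` is at most `1 / M⁻¹_ii`, so `c` is concentrated at `i`, which determines `w`.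
  have hci : 1 / M⁻¹ i i ≤ c i := by
    have := hcoord i
    rw [hwi] at this
    rw [div_le_iff₀ hpos]
    linarith
  have hothers : ∑ k : {k : Fin L // k ≠ i}, c k = 0 := by
    refine le_antisymm ?_ (Finset.sum_nonneg fun k _ => hc k)
    rw [kappaStar] at hκ
    linarith
  have hzero : ∀ k : {k : Fin L // k ≠ i}, c k = 0 := fun k =>
    (Finset.sum_eq_zero_iff_of_nonneg fun k _ => hc _).1 hothers k (Finset.mem_univ k)
  have hci' : c i * M⁻¹ i i = 1 := by
    have := hcoord i
    simp only [hwi, hzero, zero_mul, Finset.sum_const_zero, add_zero] at this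
    exact this.symm
  funext j
  have := hcoord j
  simp only [hwj, hzero, zero_mul, Finset.sum_const_zero, add_zero] at this
  rw [nuStar, eq_div_iff hpos.ne']
  linear_combination (-M⁻¹ i i) * this - M⁻¹ i j * hci'

end Identifiability

/-! ### Stability of the maximal weights -/

section Stability

variable {d L : ℕ} {P : Fin L → Measure (Space d)} [∀ k, IsProbabilityMeasure (P k)]
  {M : Matrix (Fin L) (Fin L) ℝ} {𝒮 : Set (Set (Space d))}

/-- Nonnegativity of `ν` makes the combination a genuine measure, so richness extends the constraint
from `𝒮` to all Borel sets. -/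
lemma eq_nuStar_of_rich (hirr : JointlyIrreducible P) (hM : M ∈ Matrix.rowStochastic ℝ (Fin L))
    (hB : LowNoise M) (hS : ∀ S ∈ 𝒮, MeasurableSet S) (hrich : IsRich 𝒮) (i : Fin L)
    {ν : {j : Fin L // j ≠ i} → ℝ} (hν : ∀ j, 0 ≤ ν j) (hκ : kappaStar M i ≤ ∑ j, ν j)
    (hle : ∀ S ∈ 𝒮, ∑ j, ν j * (contaminated M P j).real S ≤ (contaminated M P i).real S) :
    ν = nuStar M i := by
  have hprob := fun j => isProbabilityMeasure_contaminated (P := P) hM j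
  let Q : {j : Fin L // j ≠ i} → Measure (Space d) := fun j => contaminated M P j
  have hQ : ∀ j, IsFiniteMeasure (Q j) := fun j => inferInstanceAs
    (IsFiniteMeasure (contaminated M P j))
  have hfin := isFiniteMeasure_sum_ofReal_smul Q ν
  have hmeas : ∑ j, ENNReal.ofReal (ν j) • Q j ≤ contaminated M P i := by
    refine hrich.measure_le hS fun S hSm => ?_
    have h := hle S hSm
    rw [← real_sum_ofReal_smul Q hν S, measureReal_def, measureReal_def] at h
    exact (ENNReal.toReal_le_toReal (measure_ne_top _ _) (measure_ne_top _ _)).1 h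
  refine hirr.eq_nuStar hM hB i hκ fun A _ => ?_
  rw [← real_sum_ofReal_smul Q hν A, measureReal_def, measureReal_def]
  exact ENNReal.toReal_mono (measure_ne_top _ _) (hmeas A)

/-- Nearly admissible weights of nearly maximal mass are close to the maximal weights. -/
theorem exists_slack (hirr : JointlyIrreducible P) (hM : M ∈ Matrix.rowStochastic ℝ (Fin L))
    (hB : LowNoise M) (hS : ∀ S ∈ 𝒮, MeasurableSet S) (hrich : IsRich 𝒮) (i : Fin L)
    {η : ℝ} (hη : 0 < η) :
    ∃ δ > 0, ∀ ν : {j : Fin L // j ≠ i} → ℝ, (∀ j, 0 ≤ ν j) → kappaStar M i ≤ ∑ j, ν j →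
      ∑ j, ν j ≤ 2 →
      (∀ S ∈ 𝒮, ∑ j, ν j * (contaminated M P j).real S ≤ (contaminated M P i).real S + δ) →
      ∑ j, |ν j - nuStar M i j| < η := by
  by_contra! hcon
  -- Counterexamples with slack tending to `0` stay in the box `[0, 2]`; a limit point is exactly
  -- admissible, hence equal to `nuStar`.
  choose ν hν0 hνκ hν2 hνS hνη using fun k : ℕ => hcon (1 / ((k : ℝ) + 1)) Nat.one_div_pos_of_nat
  have hK : ∀ k, ν k ∈ Set.Icc (0 : {j : Fin L // j ≠ i} → ℝ) (fun _ => 2) := fun k =>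
    ⟨hν0 k, fun j => (Finset.single_le_sum (fun j _ => hν0 k j) (Finset.mem_univ j)).trans (hν2 k)⟩
  obtain ⟨ν', -, φ, hφ, hlim⟩ := isCompact_Icc.tendsto_subseq hK
  have hj : ∀ j, Tendsto (fun k => ν (φ k) j) atTop (nhds (ν' j)) := fun j =>
    ((continuous_apply j).tendsto ν').comp hlim
  have heq : ν' = nuStar M i := by
    refine eq_nuStar_of_rich hirr hM hB hS hrich i
      (fun j => ge_of_tendsto' (hj j) fun k => hν0 _ j)
      (ge_of_tendsto' (tendsto_finsetSum _ fun j _ => hj j) fun k => hνκ _) fun S hSm => ?_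
    have hr : Tendsto (fun k => (contaminated M P i).real S + 1 / ((φ k : ℝ) + 1)) atTop
        (nhds ((contaminated M P i).real S + 0)) :=
      tendsto_const_nhds.add (tendsto_one_div_add_atTop_nhds_zero_nat.comp hφ.tendsto_atTop)
    rw [add_zero] at hr
    exact le_of_tendsto_of_tendsto'
      (tendsto_finsetSum _ fun j _ => (hj j).mul_const _) hr fun k => hνS _ S hSm
  have hdist : Tendsto (fun k => ∑ j, |ν (φ k) j - nuStar M i j|) atTop (nhds 0) := by
    have := tendsto_finsetSum Finset.univ fun j _ => ((hj j).sub_const (nuStar M i j)).abs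
    simpa [heq] using this
  exact absurd (ge_of_tendsto' hdist fun k => hνη _) (not_le.2 hη)

end Stability

/-! ### The estimators -/

section Estimator

variable {α : Type*} {L : ℕ} {𝒮 : Set (Set α)} {V : ℕ} {n : Fin L → ℕ} {x : Fin L → ℕ → α}
  {i : Fin L}

lemma empirical_nonneg (y : ℕ → α) (m : ℕ) (S : Set α) : 0 ≤ empirical y m S :=
  div_nonneg (Finset.sum_nonneg fun _ _ => Set.indicator_nonneg (fun _ _ => zero_le_one) _)
    (Nat.cast_nonneg _)

lemma empirical_le_one (y : ℕ → α) (m : ℕ) (S : Set α) : empirical y m S ≤ 1 := by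
  refine div_le_one_of_le₀ ?_ (Nat.cast_nonneg _)
  calc ∑ j ∈ Finset.range m, S.indicator (1 : α → ℝ) (y j) ≤ ∑ _j ∈ Finset.range m, (1 : ℝ) :=
        Finset.sum_le_sum fun j _ => Set.indicator_le_self' (fun _ _ => zero_le_one) _
    _ = m := by simp

lemma ratio_num_pos (hn : ∀ k, 1 ≤ n k) (S : Set α) :
    0 < empirical (x i) (n i) S + epsRadius V (n i) (1 / n i) :=
  add_pos_of_nonneg_of_pos (empirical_nonneg _ _ _) (epsRadius_pos (hn i))

/-- Clearing denominators also covers the infinite ratios: for a nonpositive denominator the linear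
inequality is automatic, the numerator being positive. -/
lemma ofReal_le_objective_iff (hn : ∀ k, 1 ≤ n k) {c : ℝ} (hc : 0 ≤ c)
    (μ : {j : Fin L // j ≠ i} → ℝ) :
    ENNReal.ofReal c ≤ objective 𝒮 V n x i μ ↔ ∀ S ∈ 𝒮, c * ratioDenom V n x i μ S
      ≤ empirical (x i) (n i) S + epsRadius V (n i) (1 / n i) := by
  rw [objective, le_iInf₂_iff]
  refine forall₂_congr fun S _ => ?_
  have hnum := ratio_num_pos (V := V) (x := x) (i := i) hn S
  rw [ratio]
  split_ifs with h
  · exact iff_of_true le_top ((mul_nonpos_of_nonneg_of_nonpos hc h).trans hnum.le)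
  · have h' := not_le.1 h
    rw [ENNReal.ofReal_le_ofReal_iff (div_pos hnum h').le, le_div_iff₀ h']

/-- The ratio is a positive constant times an inverse in `[0, ∞]`, which is continuous through a
vanishing denominator. Positivity of the numerator gives the value `∞` there. -/
lemma continuous_ratio (hn : ∀ k, 1 ≤ n k) (S : Set α) :
    Continuous fun μ => ratio V n x i μ S := by
  have hnum := ratio_num_pos (V := V) (x := x) (i := i) hn S
  have heq : (fun μ => ratio V n x i μ S) = fun μ =>
      ENNReal.ofReal (empirical (x i) (n i) S + epsRadius V (n i) (1 / n i))
        * (ENNReal.ofReal (ratioDenom V n x i μ S))⁻¹ := by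
    funext μ
    rw [ratio]
    split_ifs with h
    · rw [ENNReal.ofReal_of_nonpos h, ENNReal.inv_zero, ENNReal.mul_top]
      simpa using hnum
    · rw [ENNReal.ofReal_div_of_pos (not_le.1 h), ENNReal.div_eq_inv_mul, mul_comm]
  rw [heq]
  refine (ENNReal.continuous_const_mul ENNReal.ofReal_ne_top).comp
    (continuous_inv.comp (ENNReal.continuous_ofReal.comp ?_))
  unfold ratioDenom
  fun_prop

/-- The maximum defining `κ̂_i` is attained. -/
theorem exists_isMaximizingWeight (hL : 2 ≤ L) (hn : ∀ k, 1 ≤ n k) :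
    ∃ μ, IsMaximizingWeight 𝒮 V n x i μ := by
  have : Nontrivial (Fin L) := Fin.nontrivial_iff_two_le.2 hL
  obtain ⟨j, hj⟩ := exists_ne i
  -- An infimum of continuous functions is upper semicontinuous, so it attains its maximum on the
  -- compact simplex, nonempty because `L ≥ 2`.
  have husc : UpperSemicontinuous (objective 𝒮 V n x i) := by
    unfold objective
    exact upperSemicontinuous_iInf fun S => upperSemicontinuous_iInf fun _ =>
      (continuous_ratio hn S).upperSemicontinuous
  obtain ⟨μ, hμ, hmax⟩ := (husc.upperSemicontinuousOn _).exists_isMaxOn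
    ⟨_, single_mem_stdSimplex ℝ (⟨j, hj⟩ : {j : Fin L // j ≠ i})⟩
    (isCompact_stdSimplex ℝ {j : Fin L // j ≠ i})
  exact ⟨μ, hμ, le_antisymm (le_iSup₂ (f := fun μ _ => objective 𝒮 V n x i μ) μ hμ)
    (iSup₂_le fun _ h => hmax h)⟩

/-- On the event of small deviations, every lower bound of the objective gives nearly admissible
weights. -/
lemma sum_mul_real_le_add [MeasurableSpace α] {F : Fin L → Measure α}
    (hn : ∀ k, 1 ≤ n k) {e : ℝ}
    (he : ∀ k, epsRadius V (n k) (1 / n k) ≤ e)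
    (hE : ∀ k, ∀ S ∈ 𝒮, |empirical (x k) (n k) S - (F k).real S|
      ≤ epsRadius V (n k) (1 / n k))
    {μ : {j : Fin L // j ≠ i} → ℝ} (hμ : μ ∈ stdSimplex ℝ {j : Fin L // j ≠ i}) {c : ℝ}
    (hc : 0 ≤ c) (hc2 : c ≤ 2) (hobj : ENNReal.ofReal c ≤ objective 𝒮 V n x i μ) :
    ∀ S ∈ 𝒮, ∑ j, (c * μ j) * (F j).real S ≤ (F i).real S + 6 * e := by
  intro S hSm
  have h := (ofReal_le_objective_iff hn hc μ).1 hobj S hSm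
  have hepos : 0 ≤ e := (epsRadius_pos (hn i)).le.trans (he i)
  have hsum : ∑ j : {j : Fin L // j ≠ i}, μ j * (F j).real S - 2 * e
      ≤ ratioDenom V n x i μ S := by
    have h2 : ∑ j, μ j * (2 * e) = 2 * e := by rw [← Finset.sum_mul, hμ.2, one_mul]
    rw [ratioDenom, ← Finset.sum_sub_distrib, ← h2, ← Finset.sum_sub_distrib]
    refine Finset.sum_le_sum fun j _ => ?_
    rw [← mul_sub, ← mul_sub]
    refine mul_le_mul_of_nonneg_left ?_ (hμ.1 j)
    linarith [(abs_le.1 (hE j S hSm)).1, he j]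
  have hmul := mul_le_mul_of_nonneg_left hsum hc
  rw [mul_sub, Finset.mul_sum] at hmul
  simp_rw [← mul_assoc] at hmul
  -- The denominator costs `2 e` (radius and deviation) times `c ≤ 2`; the numerator costs `2 e`
  -- more, for a total of `6 e`.
  have hce : c * 2 * e ≤ 4 * e := by nlinarith
  linarith [(abs_le.1 (hE i S hSm)).2, he i]

end Estimator

/-! ### Consistency -/

section Consistency

variable {d L : ℕ} {P : Fin L → Measure (Space d)} [∀ k, IsProbabilityMeasure (P k)]
  {M : Matrix (Fin L) (Fin L) ℝ} {𝒮 : Set (Set (Space d))} {V : ℕ} {n : Fin L → ℕ}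
  {x : Fin L → ℕ → Space d} {i : Fin L}

/-- On the event of small deviations, `κ̂_i` is at least its population version. -/
lemma kappaStar_le_kappaHat (hL : 2 ≤ L) (hM : M ∈ Matrix.rowStochastic ℝ (Fin L))
    (hB : LowNoise M) (hn : ∀ k, 1 ≤ n k)
    (hE : ∀ k, ∀ S ∈ 𝒮, |empirical (x k) (n k) S - (contaminated M P k).real S|
      ≤ epsRadius V (n k) (1 / n k)) :
    ENNReal.ofReal (kappaStar M i) ≤ kappaHat 𝒮 V n x i := by
  have hκ0 := kappaStar_nonneg hM hB i
  obtain ⟨μ, hμ, hμν⟩ : ∃ μ ∈ stdSimplex ℝ {j : Fin L // j ≠ i},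
      ∀ j, kappaStar M i * μ j = nuStar M i j := by
    rcases hκ0.eq_or_lt with h0 | hpos
    -- Here `nuStar` vanishes and cannot be normalized; any point of the simplex works, and a
    -- maximizer merely supplies one.
    · obtain ⟨μ, hμ, -⟩ := exists_isMaximizingWeight (𝒮 := 𝒮) (V := V) (x := x) (i := i) hL hn
      refine ⟨μ, hμ, fun j => ?_⟩
      have := (Finset.sum_eq_zero_iff_of_nonneg fun j _ => nuStar_nonneg hB i j).1
        ((sum_nuStar hM hB i).trans h0.symm) j (Finset.mem_univ j)
      rw [this, ← h0, zero_mul]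
    · refine ⟨fun j => nuStar M i j / kappaStar M i,
        ⟨fun j => div_nonneg (nuStar_nonneg hB i j) hκ0, ?_⟩, fun j => mul_div_cancel₀ _ hpos.ne'⟩
      rw [← Finset.sum_div, sum_nuStar hM hB, div_self hpos.ne']
  refine le_trans ?_ (le_iSup₂ (f := fun μ _ => objective 𝒮 V n x i μ) μ hμ)
  rw [ofReal_le_objective_iff hn hκ0]
  intro S hSm
  calc kappaStar M i * ratioDenom V n x i μ S
      = ∑ j : {j : Fin L // j ≠ i}, nuStar M i j
          * (empirical (x j) (n j) S - epsRadius V (n j) (1 / n j)) := by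
        rw [ratioDenom, ← Finset.sum_sub_distrib, Finset.mul_sum]
        exact Finset.sum_congr rfl fun j _ => by rw [← hμν j]; ring
    _ ≤ ∑ j : {j : Fin L // j ≠ i}, nuStar M i j * (contaminated M P j).real S := by
        refine Finset.sum_le_sum fun j _ => mul_le_mul_of_nonneg_left ?_ (nuStar_nonneg hB i j)
        linarith [(abs_le.1 (hE j S hSm)).2]
    _ ≤ (contaminated M P i).real S := sum_nuStar_mul_le hM hB i S
    _ ≤ _ := by linarith [(abs_le.1 (hE i S hSm)).1]

/-- On the event of small deviations, weights close to the maximal ones yield a residue close to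
the base distribution. -/
lemma abs_residue_sub_le (hM : M ∈ Matrix.rowStochastic ℝ (Fin L)) (hB : LowNoise M) {e η : ℝ}
    (hη : η ≤ (1 - kappaStar M i) / 2) {S : Set (Space d)}
    (hE : ∀ k, |empirical (x k) (n k) S - (contaminated M P k).real S| ≤ e)
    {ν : {j : Fin L // j ≠ i} → ℝ} (hν : ∑ j, |ν j - nuStar M i j| ≤ η) :
    |(empirical (x i) (n i) S - ∑ j, ν j * empirical (x j) (n j) S) / (1 - ∑ j, ν j)
        - (P i).real S| ≤ 4 * (η + e) / (1 - kappaStar M i) := by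
  set D := 1 - kappaStar M i with hD
  have hDpos : 0 < D := sub_pos.2 (kappaStar_lt_one hB i)
  have he : 0 ≤ e := (abs_nonneg _).trans (hE i)
  have hdiff : |∑ j, ν j - kappaStar M i| ≤ η := by
    rw [← sum_nuStar hM hB, ← Finset.sum_sub_distrib]
    exact (Finset.abs_sum_le_sum_abs _ _).trans hν
  -- Keeping the denominator above `D / 2` turns the numerator error `2 (η + e)` into `4 (η + e) /
  -- D`.
  have hD' : D / 2 ≤ 1 - ∑ j, ν j := by linarith [(abs_le.1 hdiff).2]
  have hres := contaminated_sub_sum_nuStar (P := P) hM hB i S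
  have hterm : |∑ j : {j : Fin L // j ≠ i}, (ν j * empirical (x j) (n j) S
      - nuStar M i j * (contaminated M P j).real S)| ≤ η + e := by
    calc _ ≤ ∑ j : {j : Fin L // j ≠ i}, (|ν j - nuStar M i j| + nuStar M i j * e) := by
          refine (Finset.abs_sum_le_sum_abs _ _).trans (Finset.sum_le_sum fun j _ => ?_)
          have : ν j * empirical (x j) (n j) S - nuStar M i j * (contaminated M P j).real S
              = (ν j - nuStar M i j) * empirical (x j) (n j) S + nuStar M i j
                * (empirical (x j) (n j) S - (contaminated M P j).real S) := by ring
          rw [this]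
          refine (abs_add_le _ _).trans (add_le_add ?_ ?_)
          · rw [abs_mul, abs_of_nonneg (empirical_nonneg _ _ _)]
            exact mul_le_of_le_one_right (abs_nonneg _) (empirical_le_one _ _ _)
          · rw [abs_mul, abs_of_nonneg (nuStar_nonneg hB i j)]
            exact mul_le_mul_of_nonneg_left (hE j) (nuStar_nonneg hB i j)
      _ ≤ η + e := by
          rw [Finset.sum_add_distrib, ← Finset.sum_mul, sum_nuStar hM hB]
          exact add_le_add hν (mul_le_of_le_one_left he (kappaStar_lt_one hB i).le)
  rw [Finset.sum_sub_distrib] at hterm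
  have hp0 : 0 ≤ (P i).real S := measureReal_nonneg
  have hp1 : (P i).real S ≤ 1 := measureReal_le_one
  have hden : 0 < 1 - ∑ j, ν j := by linarith
  have hprod : |(∑ j, ν j - kappaStar M i) * (P i).real S| ≤ η := by
    rw [abs_mul, abs_of_nonneg hp0]
    exact (mul_le_of_le_one_right (abs_nonneg _) hp1).trans hdiff
  have hnum : |empirical (x i) (n i) S - ∑ j, ν j * empirical (x j) (n j) S
      - (P i).real S * (1 - ∑ j, ν j)| ≤ 2 * (η + e) := by
    have h1 := abs_le.1 (hE i)
    have h2 := abs_le.1 hterm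
    have h3 := abs_le.1 hprod
    have h4 : (∑ j, ν j - kappaStar M i) * (P i).real S
        = D * (P i).real S - (P i).real S * (1 - ∑ j, ν j) := by rw [hD]; ring
    rw [h4] at h3
    rw [abs_le]
    constructor <;> linarith [h1.1, h1.2, h2.1, h2.2, h3.1, h3.2]
  rw [div_sub' hden.ne', abs_div, abs_of_pos hden, div_le_div_iff₀ hden hDpos,
    mul_comm (1 - ∑ j, ν j)]
  have hηe : 0 ≤ η + e := by linarith [abs_nonneg (∑ j, ν j - kappaStar M i)]
  calc _ ≤ 2 * (η + e) * D := mul_le_mul_of_nonneg_right hnum hDpos.le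
    _ = 4 * (η + e) * (D / 2) := by ring
    _ ≤ _ := mul_le_mul_of_nonneg_left hD' (by positivity)

/-- On the event of small deviations, the estimators are uniformly close to the base
distributions. -/
theorem exists_supDev_lt (hL : 2 ≤ L) (hirr : JointlyIrreducible P)
    (hM : M ∈ Matrix.rowStochastic ℝ (Fin L)) (hB : LowNoise M)
    (hS : ∀ S ∈ 𝒮, MeasurableSet S) (hrich : IsRich 𝒮) (V : ℕ) (i : Fin L) {ε : ℝ} (hε : 0 < ε) :
    ∃ e > 0, ∀ (n : Fin L → ℕ) (x : Fin L → ℕ → Space d) (μ : {j : Fin L // j ≠ i} → ℝ),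
      (∀ k, 1 ≤ n k) → (∀ k, epsRadius V (n k) (1 / n k) ≤ e) →
      (∀ k, ∀ S ∈ 𝒮, |empirical (x k) (n k) S - (contaminated M P k).real S|
        ≤ epsRadius V (n k) (1 / n k)) →
      IsMaximizingWeight 𝒮 V n x i μ → supDev 𝒮 (QHat 𝒮 V n x i μ) (P i) < ε := by
  have hDpos : 0 < 1 - kappaStar M i := sub_pos.2 (kappaStar_lt_one hB i)
  set D := 1 - kappaStar M i with hD
  have hD1 : D ≤ 1 := by linarith [kappaStar_nonneg hM hB i]
  -- `D / 2` protects the denominator, `δ / 6` matches the slack `6 e`, and the two bounds `ε D /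
  -- 16` give `4 (η + e) / D ≤ ε / 2`.
  obtain ⟨δ, hδ, hslack⟩ := exists_slack hirr hM hB hS hrich i
    (η := min (D / 2) (ε * D / 16)) (lt_min (by positivity) (by positivity))
  refine ⟨min (δ / 6) (ε * D / 16), lt_min (by positivity) (by positivity),
    fun n x μ hn he hE hμ => ?_⟩
  set e := min (δ / 6) (ε * D / 16) with he_def
  have hκ := kappaStar_le_kappaHat (i := i) hL hM hB hn hE
  set K := kappaHat 𝒮 V n x i with hK
  -- `K` may be infinite or large, so it is first truncated at `2`. Closeness to `nuStar` then gives
  -- `c < 2`, so the truncation was inactive.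
  let c := (min K 2).toReal
  have hcK : ENNReal.ofReal c = min K 2 := ENNReal.ofReal_toReal (by simp)
  have hc0 : 0 ≤ c := ENNReal.toReal_nonneg
  have hc2 : c ≤ 2 := by
    have := ENNReal.toReal_mono (by simp) (min_le_right K 2)
    simpa using this
  have hκc : kappaStar M i ≤ c := by
    refine (ENNReal.ofReal_le_ofReal_iff hc0).1 ?_
    rw [hcK]
    refine le_min hκ ?_
    rw [← ENNReal.ofReal_ofNat 2]
    exact ENNReal.ofReal_le_ofReal (by linarith)
  have hadm := sum_mul_real_le_add hn he hE hμ.1 hc0 hc2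
    (by rw [hcK, hμ.2]; exact min_le_left _ _)
  have hsum : ∑ j, c * μ j = c := by rw [← Finset.mul_sum, hμ.1.2, mul_one]
  have hclose := hslack (fun j => c * μ j) (fun j => mul_nonneg hc0 (hμ.1.1 j))
    (by rw [hsum]; exact hκc) (by rw [hsum]; exact hc2) fun S hSm =>
      (hadm S hSm).trans (by linarith [min_le_left (δ / 6) (ε * D / 16)])
  have hclt : c < 2 := by
    have h1 : |∑ j, (c * μ j - nuStar M i j)| < min (D / 2) (ε * D / 16) :=
      (Finset.abs_sum_le_sum_abs _ _).trans_lt hclose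
    rw [Finset.sum_sub_distrib, hsum, sum_nuStar hM hB] at h1
    linarith [(abs_lt.1 h1).2, min_le_left (D / 2) (ε * D / 16)]
  have hKc : K.toReal = c := by
    have hlt : min K 2 < 2 := by
      rw [← hcK, ← ENNReal.ofReal_ofNat 2]
      exact (ENNReal.ofReal_lt_ofReal_iff two_pos).2 hclt
    have hK2 : K < 2 := by simpa using hlt
    simp only [c, min_eq_left hK2.le]
  have hbound : ∀ S : 𝒮, |QHat 𝒮 V n x i μ S - (P i).real S| ≤ ε / 2 := fun S => by
    have h := abs_residue_sub_le (P := P) (n := n) (x := x) (e := e) hM hB (min_le_left _ _)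
      (fun k => (hE k S S.2).trans (he k)) hclose.le
    rw [hsum] at h
    rw [QHat, ← hK, hKc]
    refine h.trans ?_
    rw [div_le_iff₀ hDpos]
    linarith [min_le_right (δ / 6) (ε * D / 16), min_le_right (D / 2) (ε * D / 16)]
  exact (Real.iSup_le hbound (half_pos hε).le).trans_lt (half_lt_self hε)

end Consistency

end MutualContamination

end

theorem mainTheorem7 {d L : ℕ} (hL : 2 ≤ L)
    -- the base distributions and the mixing matrix
    (P : Fin L → Measure (MutualContamination.Space d)) (hP : ∀ i, IsProbabilityMeasure (P i))
    (hirr : MutualContamination.JointlyIrreducible P)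
    (M : Matrix (Fin L) (Fin L) ℝ) (hM : M ∈ Matrix.rowStochastic ℝ (Fin L))
    (hB1 : MutualContamination.LowNoise M)
    -- the VC class
    (𝒮 : Set (Set (MutualContamination.Space d))) (V : ℕ)
    (hS : ∀ S ∈ 𝒮, MeasurableSet S) (hV : MutualContamination.HasVCDim 𝒮 V)
    (hrich : MutualContamination.IsRich 𝒮)
    (hmeas : ∀ i, MutualContamination.IsMeasurableClass 𝒮
      (MutualContamination.contaminated M P i))
    -- the samples
    {Ω : Type*} [MeasurableSpace Ω] (Pr : Measure Ω) [IsProbabilityMeasure Pr]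
    (X : Fin L → ℕ → Ω → MutualContamination.Space d)
    (hlaw : ∀ i j, HasLaw (X i j) (MutualContamination.contaminated M P i) Pr)
    (hindep : ∀ i, iIndepFun (X i) Pr) :
    -- the maximum defining `κ̂_i` is attained
    (∀ n : Fin L → ℕ, (∀ i, 1 ≤ n i) → ∀ (ω : Ω) (i : Fin L),
      ∃ μ : {j : Fin L // j ≠ i} → ℝ,
        MutualContamination.IsMaximizingWeight 𝒮 V n (fun k j => X k j ω) i μ) ∧
    -- whatever maximizing weights are chosen, the estimators converge uniformly over `𝒮`,
    -- in probability, as `min_i n i → ∞`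
    (∀ μHat : (Fin L → ℕ) → Ω → (i : Fin L) → {j : Fin L // j ≠ i} → ℝ,
      (∀ n : Fin L → ℕ, (∀ i, 1 ≤ n i) → ∀ (ω : Ω) (i : Fin L),
        MutualContamination.IsMaximizingWeight 𝒮 V n (fun k j => X k j ω) i (μHat n ω i)) →
      ∀ i : Fin L,
        TendstoInMeasure Pr
          (fun (n : Fin L → ℕ) (ω : Ω) => MutualContamination.supDev 𝒮
            (MutualContamination.QHat 𝒮 V n (fun k j => X k j ω) i (μHat n ω i)) (P i))
          (atTop : Filter (Fin L → ℕ)) (fun _ => 0)) := by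
  refine ⟨fun n hn ω i => MutualContamination.exists_isMaximizingWeight hL hn,
    fun μHat hμHat i ε hε => ?_⟩
  have hprob := fun j => MutualContamination.isProbabilityMeasure_contaminated (P := P) hM j
  -- The threshold ranges over extended reals, including `⊤`.
  obtain ⟨ε', hε', hεε'⟩ : ∃ ε' : ℝ, 0 < ε' ∧ ENNReal.ofReal ε' ≤ ε := by
    rcases eq_or_ne ε ⊤ with rfl | htop
    · exact ⟨1, one_pos, le_top⟩
    · exact ⟨ε.toReal, ENNReal.toReal_pos hε.ne' htop, ENNReal.ofReal_toReal_le⟩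
  obtain ⟨e, he, hdev⟩ := MutualContamination.exists_supDev_lt hL hirr hM hB1 hS hrich V i hε'
  have hcoord : ∀ k : Fin L, Tendsto (fun n : Fin L → ℕ => n k) atTop atTop := fun k =>
    tendsto_atTop.2 fun N => (eventually_ge_atTop fun _ => N).mono fun n hn => hn k
  have hlim : Tendsto (fun n : Fin L → ℕ => ∑ k, ENNReal.ofReal (2 ^ V / n k)) atTop (nhds 0) := by
    have hreal : Tendsto (fun m : ℕ => ENNReal.ofReal (2 ^ V / (m : ℝ))) atTop (nhds 0) := by
      rw [← ENNReal.ofReal_zero]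
      exact ENNReal.tendsto_ofReal (tendsto_const_div_atTop_nhds_zero_nat _)
    simpa using tendsto_finsetSum Finset.univ fun k _ => hreal.comp (hcoord k)
  refine tendsto_of_tendsto_of_tendsto_of_le_of_le' tendsto_const_nhds hlim
    (Eventually.of_forall fun _ => zero_le) ?_
  have hev1 : ∀ᶠ n : Fin L → ℕ in atTop, ∀ k, 1 ≤ n k :=
    eventually_all.2 fun k => (hcoord k).eventually_ge_atTop 1
  have hev2 : ∀ᶠ n : Fin L → ℕ in atTop,
      ∀ k, MutualContamination.epsRadius V (n k) (1 / n k) ≤ e :=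
    eventually_all.2 fun k => (((MutualContamination.tendsto_epsRadius V).comp
      (hcoord k)).eventually_lt_const he).mono fun _ h => h.le
  filter_upwards [hev1, hev2] with n hn hne
  -- Outside the union of the `L` deviation events the bound is deterministic; monotonicity and the
  -- union bound hold for arbitrary, possibly nonmeasurable, sets.
  refine le_trans (measure_mono ?_) ((measure_iUnion_fintype_le Pr fun k =>
    {ω | ∃ S ∈ 𝒮, MutualContamination.epsRadius V (n k) (1 / n k)
      < |MutualContamination.empirical (fun j => X k j ω) (n k) S
        - (MutualContamination.contaminated M P k).real S|}).trans
    (Finset.sum_le_sum fun k _ => MutualContamination.measure_empirical_deviation_le hV hS (hmeas k)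
      (hlaw k) (hindep k) (hn k)))
  intro ω hω
  by_contra hgood
  simp only [Set.mem_iUnion, Set.mem_ofPred_eq, not_exists, not_and, not_lt] at hgood
  have hlt := hdev n (fun k j => X k j ω) (μHat n ω i) hn hne hgood (hμHat n hn ω i)
  have hnonneg : 0 ≤ MutualContamination.supDev 𝒮 (MutualContamination.QHat 𝒮 V n
      (fun k j => X k j ω) i (μHat n ω i)) (P i) := Real.iSup_nonneg fun _ => abs_nonneg _
  rw [Set.mem_ofPred_eq, edist_dist, Real.dist_eq, sub_zero, abs_of_nonneg hnonneg] at hω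
  exact absurd ((ENNReal.ofReal_le_ofReal_iff hnonneg).1 (hεε'.trans hω)) (not_le.2 hlt)
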